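/- Let $X$ be a compact connected Riemann surface of genus $g$ (the dimension of its space of holomorphic one-forms), $p_\infty\in X$, and let $L=\mathcal O(D)$ be a flat line bundle on $X$, where $D$ is a divisor of degree $0$. (For a zero $e$ of Riemann's theta function and Riemann's constant $\delta$, the bundle $L_{e+\delta}$ is the case $D=q_1+\cdots+q_{g-1}-(g-1)p_\infty$ with $q_i\in X$.) An integer $b\ge 0$ is a *non-gap* of $L$ if there is a meromorphic section of $L$, holomorphic on $X\setminus\{p_\infty\}$, with a pole of order exactly $b$ at $p_\infty$; otherwise it is a *gap*. Let $b_1<\cdots<b_g$ be the gaps and $b_1^*<b_2^*<\cdots$ the non-gaps of $L$. Put $\lambda=(b_g,\dots,b_1)-(g-1,\dots,1,0)$, $m_k=h^0(D+(g-1-k)p_\infty)$ and $$A_k=(b_{g-k},b_{g-k-1},\dots,b_{g-k-m_k+1})-(b_1^*,\dots,b_{m_k}^*),$$ and let $c_k=\pm1$ be the sign of the permutation of $\{0,1,\dots,g-k-1\}$ $$\begin{pmatrix} b_1^*&\cdots&b_{m_k}^*&b_{g-k-m_k}&\cdots&b_1\\ g-k-1&\cdots&\cdot&\cdot&\cdots&0\end{pmatrix}.$$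 For a partition $\mu=(\mu_1,\dots,\mu_l)$, identified with $(\mu_1,\dots,\mu_l,0,\dots,0)$, let $|\mu|=\mu_1+\cdots+\mu_l$ and $s_\mu(t)=\det(p_{\mu_i-i+j}(t))_{1\le i,j\le l}$, where $\exp\bigl(\sum_{n\ge1}t_nz^n\bigr)=\sum_{n\ge0}p_n(t)z^n$ and $p_n=0$ for $n<0$; $s_\mu=1$ for the empty partition. Let $[x]=(x,x^2/2,x^3/3,\dots)$ and, for a sequence $I=(i_1,\dots,i_m)$ of positive integers, $\partial_{t,I}=\partial_{t_{i_1}}\cdots\partial_{t_{i_m}}$. 1. Let $0\le k\le g-1$ with $m_k>0$, and let $\mu$ be a partition with $\mu_i=\lambda_i$ for all $i\ge k+1$. Then, for all $x_1,\dots,x_k\in\mathbb C$, $$\partial_{t,A_k}s_\mu\Bigl(\sum_{i=1}^k[x_i]\Bigr)=c_k\,s_{(\mu_1,\dots,\mu_k)}\Bigl(\sum_{i=1}^k[x_i]\Bigr).$$ 2. (i) For every partition $\mu$ and every $I=(i_1,\dots,i_m)$ with $m\ge1$ and $\sum_j i_j\ne|\mu|$, one has $\partial_{t,I}s_\mu(0)=0$.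 (ii) If $\mu$ is a partition with $\mu_i\ge\lambda_i$ for all $i$, then $\partial_{t,I}s_\mu(0)=0$ for every $I=(i_1,\dots,i_m)$ with $0\le m<m_0$. (iii) $\partial_{t,A_0}s_\lambda(0)=c_0$. -/

import Mathlib

open scoped Manifold ContDiff Topology

noncomputable section

namespace RiemannSchur

section Surface

variable (X : Type*) [TopologicalSpace X] [ChartedSpace ℂ X]

/-- The space of holomorphic one-forms: analytic sections of the holomorphic cotangent bundle. -/
abbrev HolOneForm [IsManifold 𝓘(ℂ) ω X] : Type _ :=
  Cₛ^ω⟮𝓘(ℂ); ℂ →L[ℂ] ℂ, fun x : X => TangentSpace 𝓘(ℂ) x →L[ℂ] Bundle.Trivial X ℂ x⟯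

/-- The genus: the dimension of the space of holomorphic one-forms. -/
def genus [IsManifold 𝓘(ℂ) ω X] : ℕ := Module.finrank ℂ (HolOneForm X)

variable {X}

/-- `f` is meromorphic at `x` (read in the chart around `x`; the values of `f` at poles are
irrelevant). -/
def MeroAt (f : X → ℂ) (x : X) : Prop :=
  MeromorphicAt (f ∘ (chartAt ℂ x).symm) (chartAt ℂ x x)

/-- The order of vanishing of `f` at `x`: negative at poles, `⊤` if `f` vanishes identically
on a punctured neighbourhood of `x`. -/
def ordAt (f : X → ℂ) (x : X) : WithTop ℤ :=
  meromorphicOrderAt (f ∘ (chartAt ℂ x).symm) (chartAt ℂ x x)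

/-- The degree of a divisor. -/
def divDegree (D : X →₀ ℤ) : ℤ := D.sum fun _ n => n

/-- The functions that are zero as meromorphic functions, i.e. zero off a discrete set. -/
def nullFun (X : Type*) [TopologicalSpace X] : Submodule ℂ (X → ℂ) where
  carrier := {f | ∀ x, ∀ᶠ y in 𝓝[≠] x, f y = 0}
  zero_mem' := by
    intro x
    simp
  add_mem' := by
    intro f g hf hg x
    filter_upwards [hf x, hg x] with y h1 h2
    simp [h1, h2]
  smul_mem' := by
    intro c f hf x
    filter_upwards [hf x] with y h1
    simp [h1]

/-- The meromorphic functions `f` with `(f) + D ≥ 0`, i.e. the global holomorphic sections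
of the line bundle `O(D)`. -/
def sectionSpace (D : X →₀ ℤ) : Submodule ℂ (X → ℂ) where
  carrier := {f | ∀ x, MeroAt f x ∧ ((-(D x) : ℤ) : WithTop ℤ) ≤ ordAt f x}
  zero_mem' := by
    intro x
    have h0 : ((0 : X → ℂ) ∘ (chartAt ℂ x).symm) = fun _ => (0 : ℂ) := rfl
    refine ⟨?_, ?_⟩
    · unfold MeroAt
      rw [h0]
      exact MeromorphicAt.const 0 _
    · have : ordAt (0 : X → ℂ) x = ⊤ := by
        unfold ordAt
        rw [h0, meromorphicOrderAt_eq_top_iff]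
        simp
      rw [this]
      exact le_top
  add_mem' := by
    intro f g hf hg x
    refine ⟨(hf x).1.add (hg x).1, ?_⟩
    exact le_trans (le_min (hf x).2 (hg x).2) (meromorphicOrderAt_add (hf x).1 (hg x).1)
  smul_mem' := by
    intro c f hf x
    have hc : MeromorphicAt (fun _ : ℂ => c) (chartAt ℂ x x) := MeromorphicAt.const c _
    refine ⟨hc.smul (hf x).1, ?_⟩
    have h1 : ordAt (c • f) x
        = meromorphicOrderAt (fun _ : ℂ => c) (chartAt ℂ x x) + ordAt f x :=
      meromorphicOrderAt_smul hc (hf x).1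
    have h2 : 0 ≤ meromorphicOrderAt (fun _ : ℂ => c) (chartAt ℂ x x) := by
      classical
      rw [meromorphicOrderAt_const]
      split_ifs <;> simp
    rw [h1]
    exact le_trans (hf x).2 (le_add_of_nonneg_left h2)

/-- `h⁰(D)`: the dimension of the space of meromorphic functions `f` with `(f) + D ≥ 0`, where
two functions that agree off a discrete set are the same meromorphic function. -/
def h0 (D : X →₀ ℤ) : ℕ :=
  Module.finrank ℂ ((sectionSpace D).map (nullFun X).mkQ)

/-- `b` is a non-gap of `O(D)` at `p`: there is a meromorphic section of `O(D)`, holomorphic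
off `p`, with a pole of order exactly `b` at `p`. A meromorphic section of `O(D)` is a meromorphic
function `f`, and its order at `x` as a section is `ord_x f + D x`. -/
def IsNonGap (D : X →₀ ℤ) (p : X) (b : ℕ) : Prop :=
  ∃ f : X → ℂ, (∀ x, MeroAt f x) ∧
    (∀ x, x ≠ p → 0 ≤ ordAt f x + ((D x : ℤ) : WithTop ℤ)) ∧
    ordAt f p + ((D p : ℤ) : WithTop ℤ) = ((-(b : ℤ) : ℤ) : WithTop ℤ)

/-- `b` is a gap of `O(D)` at `p`. -/
def IsGap (D : X →₀ ℤ) (p : X) (b : ℕ) : Prop := ¬ IsNonGap D p b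

/-- `gap D p i` is the gap `b_{i+1}`, where `b_1 < b_2 < ⋯` are the gaps of `O(D)` at `p`. -/
def gap (D : X →₀ ℤ) (p : X) (i : ℕ) : ℕ := Nat.nth (IsGap D p) i

/-- `nonGap D p i` is the non-gap `b*_{i+1}`, where `b*_1 < b*_2 < ⋯` are the non-gaps
of `O(D)` at `p`. -/
def nonGap (D : X →₀ ℤ) (p : X) (i : ℕ) : ℕ := Nat.nth (IsNonGap D p) i

variable [IsManifold 𝓘(ℂ) ω X]

/-- The partition `λ = (b_g, …, b_1) - (g-1, …, 0)`, followed by zeros: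
`gapPartition D p i` is `λ_{i+1}`. -/
def gapPartition (D : X →₀ ℤ) (p : X) (i : ℕ) : ℕ :=
  if i < genus X then gap D p (genus X - 1 - i) - (genus X - 1 - i) else 0

/-- `m_k = h⁰(D + (g-1-k) p)`; for `D = q_1 + ⋯ + q_{g-1} - (g-1) p` this is
`h⁰(q_1 + ⋯ + q_{g-1} - k p)`. -/
def mult (D : X →₀ ℤ) (p : X) (k : ℕ) : ℕ :=
  h0 (D + Finsupp.single p ((genus X : ℤ) - 1 - (k : ℤ)))

/-- The a-sequence
`A_k = (b_{g-k}, b_{g-k-1}, …, b_{g-k-m_k+1}) - (b*_1, …, b*_{m_k})`. -/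
def aSeq (D : X →₀ ℤ) (p : X) (k : ℕ) : List ℕ :=
  (List.range (mult D p k)).map fun i => gap D p (genus X - k - 1 - i) - nonGap D p i

/-- The sequence `(b*_1, …, b*_{m_k}, b_{g-k-m_k}, …, b_1)`, indexed from `0` to `g-k-1`. -/
def topRow (D : X →₀ ℤ) (p : X) (k : ℕ) (i : ℕ) : ℕ :=
  if i < mult D p k then nonGap D p i else gap D p (genus X - k - 1 - i)

/-- `σ` is the permutation of `{0, …, g-k-1}` given in two-line notation by the rows
`(b*_1, …, b*_{m_k}, b_{g-k-m_k}, …, b_1)` and `(g-k-1, …, 1, 0)`: it sends each entry of the upper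
row to the entry below it. -/
def IsGapPerm (D : X →₀ ℤ) (p : X) (k : ℕ) (σ : Equiv.Perm (Fin (genus X - k))) : Prop :=
  ∀ i : Fin (genus X - k), ((σ.symm (Fin.rev i) : Fin (genus X - k)) : ℕ) = topRow D p k i

end Surface

section Schur

/-- `μ` is a partition `(μ_1, …, μ_l)` with at most `l` non-zero parts, followed by zeros;
`μ i` is `μ_{i+1}`. -/
def IsPartition (l : ℕ) (μ : ℕ → ℕ) : Prop :=
  Antitone μ ∧ ∀ i, l ≤ i → μ i = 0

/-- The series `t_1 z + t_2 z² + ⋯` in `z` over the polynomial ring in the variables `t_n`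
(the variable with index `0` is not used). -/
def tSeries : PowerSeries (MvPolynomial ℕ ℂ) :=
  PowerSeries.mk fun n => if n = 0 then 0 else MvPolynomial.X n

/-- `p_n(t)`, the coefficient of `z^n` in `exp(t_1 z + t_2 z² + ⋯)`, and `0` for `n < 0`. -/
def schurP (n : ℤ) : MvPolynomial ℕ ℂ :=
  if 0 ≤ n then
    PowerSeries.coeff n.toNat ((PowerSeries.exp (MvPolynomial ℕ ℂ)).subst tSeries)
  else 0

/-- The Schur function `s_{(μ_1, …, μ_l)}(t) = det (p_{μ_i - i + j}(t))`. -/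
def schur (l : ℕ) (μ : ℕ → ℕ) : MvPolynomial ℕ ℂ :=
  Matrix.det (Matrix.of fun i j : Fin l => schurP ((μ i : ℤ) - (i : ℤ) + (j : ℤ)))

/-- `∂_{t,I} = ∂_{t_{i_1}} ⋯ ∂_{t_{i_m}}` for `I = (i_1, …, i_m)`. -/
def partialT (I : List ℕ) (F : MvPolynomial ℕ ℂ) : MvPolynomial ℕ ℂ :=
  I.foldr (fun i G => MvPolynomial.pderiv i G) F

/-- The point `∑_i [x_i]`, where `[x] = (x, x²/2, x³/3, …)`. -/
def bracketSum {k : ℕ} (x : Fin k → ℂ) (n : ℕ) : ℂ := ∑ i, x i ^ n / (n : ℂ)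

end Schur

end RiemannSchur

end

/-!
At a sum of `k` points the generating series `∑ p_n z^n` is `1 / ∏ (1 - x_i z)`, so column
operations kill every column but the first `k` in a row whose beta-number is at least `N - k`,
where `N` is the number of rows. A Schur determinant with more than `k` such rows therefore
vanishes there. Since `∂_{t_a} p_n = p_{n - a}`, a derivative in `t_a` lowers one beta-number by
`a`. The sequence `A_k` has just enough terms to lower the superfluous large rows, one row for
each term, and since a determinant with two equal rows vanishes, only one assignment of terms to
rows survives. It turns the lower beta-numbers into a permutation of `0, …, g - k - 1`, whose sign
is `c_k`.

The gaps and non-gaps enter through two facts: `m_k` is the number of non-gaps below `g - k`, and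
there are at least `g` gaps. The second is half of the Riemann–Roch theorem. It follows from the
residue theorem, which in turn is Stokes' formula applied to a partition of unity that is constant
near the poles.
-/

namespace RiemannSchur

noncomputable section

section GeneratingSeries

open PowerSeries

section Coefficientwise

variable {R A : Type*} [CommRing R] [CommRing A] [Algebra R A]

/-- The derivation `D` of `A` applied to each coefficient of a power series over `A`. -/
def mapCoeff (D : Derivation R A A) (f : A⟦X⟧) : A⟦X⟧ :=
  PowerSeries.mk fun n => D (coeff n f)

@[simp]
theorem coeff_mapCoeff (D : Derivation R A A) (f : A⟦X⟧) (n : ℕ) :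
    coeff n (mapCoeff D f) = D (coeff n f) :=
  coeff_mk n _

theorem mapCoeff_mul (D : Derivation R A A) (f g : A⟦X⟧) :
    mapCoeff D (f * g) = mapCoeff D f * g + f * mapCoeff D g := by
  ext1 n
  simp only [coeff_mapCoeff, coeff_mul, map_add, map_sum, ← Finset.sum_add_distrib,
    Derivation.leibniz, smul_eq_mul]
  exact Finset.sum_congr rfl fun _ _ => by ring

theorem mapCoeff_derivative (D : Derivation R A A) (f : A⟦X⟧) :
    mapCoeff D (derivative A f) = derivative A (mapCoeff D f) := by
  ext1 n
  simp only [coeff_mapCoeff, coeff_derivative, Derivation.leibniz, smul_eq_mul, map_add,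
    Derivation.map_natCast, Derivation.map_one_eq_zero]
  ring

end Coefficientwise

theorem map_derivative {R S : Type*} [CommRing R] [CommRing S] (φ : R →+* S) (f : R⟦X⟧) :
    PowerSeries.map φ (derivative R f) = derivative S (PowerSeries.map φ f) := by
  ext n
  simp [coeff_derivative]

theorem eq_zero_of_derivative_eq_mul {R : Type*} [CommRing R] [IsAddTorsionFree R]
    {f s : R⟦X⟧} (h : derivative R f = f * s) (h0 : constantCoeff f = 0) : f = 0 := by
  ext n
  induction n using Nat.strong_induction_on with
  | _ n ih =>
    cases n with
    | zero => simpa using h0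
    | succ n =>
      have hn := congrArg (coeff n) h
      rw [coeff_derivative, coeff_mul, Finset.sum_eq_zero] at hn
      · have hsmul : (n + 1) • coeff (n + 1) f = 0 := by
          rw [nsmul_eq_mul, mul_comm]
          exact_mod_cast hn
        exact nsmul_right_injective n.succ_ne_zero (hsmul.trans (nsmul_zero _).symm)
      · intro ij hij
        have := Finset.HasAntidiagonal.mem_antidiagonal.mp hij
        rw [ih ij.1 (by omega), map_zero, zero_mul]

/-- The generating series `exp (t_1 z + t_2 z² + ⋯)` of the polynomials `p_n(t)`. -/
def schurSeries : (MvPolynomial ℕ ℂ)⟦X⟧ :=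
  (PowerSeries.exp (MvPolynomial ℕ ℂ)).subst tSeries

theorem constantCoeff_tSeries : constantCoeff tSeries = 0 := by
  simp [tSeries]

theorem hasSubst_tSeries : HasSubst tSeries :=
  HasSubst.of_constantCoeff_zero' constantCoeff_tSeries

theorem derivative_schurSeries :
    derivative (MvPolynomial ℕ ℂ) schurSeries =
      schurSeries * derivative (MvPolynomial ℕ ℂ) tSeries := by
  rw [schurSeries, derivative_subst hasSubst_tSeries, derivative_exp]

theorem constantCoeff_schurSeries : constantCoeff schurSeries = 1 := by
  rw [schurSeries, ← coeff_zero_eq_constantCoeff_apply, coeff_subst' hasSubst_tSeries,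
    finsum_eq_single _ 0]
  · simp
  · intro n hn
    simp [constantCoeff_tSeries, hn]

theorem mapCoeff_pderiv_tSeries {k : ℕ} (hk : 0 < k) :
    mapCoeff (MvPolynomial.pderiv k) tSeries = X ^ k := by
  ext1 n
  rw [coeff_mapCoeff, tSeries, coeff_mk, coeff_X_pow]
  rcases eq_or_ne n k with rfl | hnk
  · simp [hk.ne']
  · by_cases hn : n = 0
    · simp [hn, hk.ne]
    · simp [hn, hnk, MvPolynomial.pderiv_X_of_ne hnk]

/-- Both sides solve `f' = f t' + k z^(k-1) exp t`, so their difference solves `f' = f t'`. -/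
theorem mapCoeff_pderiv_schurSeries {k : ℕ} (hk : 0 < k) :
    mapCoeff (MvPolynomial.pderiv k) schurSeries = X ^ k * schurSeries := by
  rw [← sub_eq_zero]
  refine eq_zero_of_derivative_eq_mul (s := derivative _ tSeries) ?_ ?_
  · rw [map_sub, ← mapCoeff_derivative, derivative_schurSeries, mapCoeff_mul,
      mapCoeff_derivative _ tSeries, mapCoeff_pderiv_tSeries hk, Derivation.leibniz,
      derivative_schurSeries]
    simp only [smul_eq_mul]
    ring
  · rw [map_sub, map_mul, map_pow, constantCoeff_X, zero_pow hk.ne', zero_mul, sub_zero,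
      ← coeff_zero_eq_constantCoeff_apply, coeff_mapCoeff, coeff_zero_eq_constantCoeff_apply,
      constantCoeff_schurSeries, Derivation.map_one_eq_zero]

theorem schurP_natCast (n : ℕ) : schurP n = coeff n schurSeries := by
  simp [schurP, schurSeries]

theorem schurP_of_neg {n : ℤ} (hn : n < 0) : schurP n = 0 := by
  simp [schurP, not_le.mpr hn]

theorem schurP_zero : schurP 0 = 1 := by
  rw [← Nat.cast_zero, schurP_natCast, coeff_zero_eq_constantCoeff_apply,
    constantCoeff_schurSeries]

theorem pderiv_schurP {k : ℕ} (hk : 0 < k) (n : ℤ) :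
    MvPolynomial.pderiv k (schurP n) = schurP (n - k) := by
  rcases lt_or_ge n 0 with hn | hn
  · rw [schurP_of_neg hn, schurP_of_neg (by omega), map_zero]
  · lift n to ℕ using hn
    have hcoeff := congrArg (coeff n) (mapCoeff_pderiv_schurSeries hk)
    rw [coeff_mapCoeff, coeff_X_pow_mul'] at hcoeff
    rw [schurP_natCast, hcoeff]
    split_ifs with hkn
    · rw [← schurP_natCast, Nat.cast_sub hkn]
    · rw [schurP_of_neg (by omega)]

section ReciprocalPoly

variable {R ι : Type*} [CommRing R] [Fintype ι]

/-- The polynomial `∏ (1 - x_i z)`, the reciprocal of the generating series of the values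
`p_n(∑ [x_i])`. -/
def reciprocalPoly (x : ι → R) : Polynomial R :=
  ∏ i, (1 - Polynomial.C (x i) * Polynomial.X)

theorem natDegree_reciprocalPoly_le (x : ι → R) :
    (reciprocalPoly x).natDegree ≤ Fintype.card ι := by
  refine (Polynomial.natDegree_prod_le _ _).trans ?_
  refine (Finset.sum_le_card_nsmul _ _ 1 fun i _ => ?_).trans (by simp)
  compute_degree

theorem coeff_zero_reciprocalPoly (x : ι → R) : (reciprocalPoly x).coeff 0 = 1 := by
  simp [reciprocalPoly, Polynomial.coeff_zero_eq_eval_zero, Polynomial.eval_prod]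

theorem coe_reciprocalPoly (x : ι → R) :
    (reciprocalPoly x : R⟦X⟧) = ∏ i, (1 - C (x i) * X) := by
  rw [reciprocalPoly, ← Polynomial.coeToPowerSeries.ringHom_apply, map_prod]
  simp

theorem mk_pow_succ_mul_one_sub (x : R) :
    (PowerSeries.mk fun n => x ^ (n + 1)) * (1 - C x * X) = C x := by
  ext n
  cases n with
  | zero => simp
  | succ n =>
    rw [mul_sub, mul_one, ← mul_assoc, map_sub, coeff_succ_mul_X, coeff_mul_C]
    simp [pow_succ]

theorem sum_mk_pow_succ_mul_prod {ι : Type*} (x : ι → R) (s : Finset ι) :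
    (∑ i ∈ s, PowerSeries.mk fun n => x i ^ (n + 1)) * ∏ i ∈ s, (1 - C (x i) * X) =
      -derivative R (∏ i ∈ s, (1 - C (x i) * X)) := by
  classical
  induction s using Finset.induction_on with
  | empty => simp
  | insert a s ha ih =>
    have hderiv : derivative R (1 - C (x a) * X) = -C (x a) := by
      simp [Derivation.leibniz]
    rw [Finset.sum_insert ha, Finset.prod_insert ha, Derivation.leibniz, hderiv]
    simp only [smul_eq_mul]
    linear_combination (∏ i ∈ s, (1 - C (x i) * X)) * mk_pow_succ_mul_one_sub (x a) +
      (1 - C (x a) * X) * ih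

end ReciprocalPoly

variable {k : ℕ}

theorem map_eval_derivative_tSeries (x : Fin k → ℂ) :
    PowerSeries.map (MvPolynomial.eval (bracketSum x)) (derivative _ tSeries) =
      ∑ i, PowerSeries.mk fun n => x i ^ (n + 1) := by
  ext n
  have hn : (n : ℂ) + 1 ≠ 0 := by exact_mod_cast n.succ_ne_zero
  simp [tSeries, coeff_derivative, bracketSum, Finset.sum_mul, hn]

theorem map_eval_schurSeries_mul (x : Fin k → ℂ) :
    PowerSeries.map (MvPolynomial.eval (bracketSum x)) schurSeries *
      (reciprocalPoly x : ℂ⟦X⟧) = 1 := by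
  set φ := MvPolynomial.eval (bracketSum x)
  refine derivative.ext ?_ ?_
  · rw [Derivation.leibniz, ← map_derivative, derivative_schurSeries, map_mul,
      map_eval_derivative_tSeries, coe_reciprocalPoly]
    simp only [smul_eq_mul, Derivation.map_one_eq_zero]
    linear_combination (PowerSeries.map φ schurSeries) * sum_mk_pow_succ_mul_prod x Finset.univ
  · rw [map_mul, ← coeff_zero_eq_constantCoeff_apply, coeff_map,
      coeff_zero_eq_constantCoeff_apply, constantCoeff_schurSeries]
    simp [coeff_zero_reciprocalPoly]

theorem sum_coeff_reciprocalPoly_mul_eval_schurP (x : Fin k → ℂ) {K : ℕ} (hK : k ≤ K) (q : ℤ) :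
    ∑ r ∈ Finset.range (K + 1),
        (reciprocalPoly x).coeff r * MvPolynomial.eval (bracketSum x) (schurP (q - r)) =
      if q = 0 then 1 else 0 := by
  set F : ℕ → ℂ := fun r =>
    (reciprocalPoly x).coeff r * MvPolynomial.eval (bracketSum x) (schurP (q - r)) with hF
  have hF_of_lt : ∀ r : ℕ, q < r → F r = 0 := fun r hr => by
    simp only [hF]
    rw [schurP_of_neg (by omega), map_zero, mul_zero]
  have hF_of_gt : ∀ r : ℕ, K < r → F r = 0 := fun r hr => by
    have hdeg := (natDegree_reciprocalPoly_le x).trans (by simpa using hK)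
    simp only [hF]
    rw [Polynomial.coeff_eq_zero_of_natDegree_lt (hdeg.trans_lt hr), zero_mul]
  rcases lt_or_ge q 0 with hq | hq
  · rw [if_neg hq.ne]
    exact Finset.sum_eq_zero fun r _ => hF_of_lt r (by omega)
  lift q to ℕ using hq
  have hcoeff : ∑ r ∈ Finset.range (q + 1), F r = if q = 0 then 1 else 0 := by
    rw [← coeff_one, ← map_eval_schurSeries_mul x, mul_comm, coeff_mul,
      Finset.Nat.sum_antidiagonal_eq_sum_range_succ_mk]
    refine Finset.sum_congr rfl fun r hr => ?_
    rw [hF, Polynomial.coeff_coe, coeff_map, ← schurP_natCast,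
      Nat.cast_sub (Nat.lt_succ_iff.mp (Finset.mem_range.mp hr))]
  simp only [Nat.cast_eq_zero]
  calc ∑ r ∈ Finset.range (K + 1), F r
      = ∑ r ∈ Finset.range (K + q + 1), F r :=
        Finset.sum_subset (Finset.range_mono (by omega)) fun r _ hr =>
          hF_of_gt r (by rw [Finset.mem_range] at hr; omega)
    _ = ∑ r ∈ Finset.range (q + 1), F r :=
        (Finset.sum_subset (Finset.range_mono (by omega)) fun r _ hr =>
          hF_of_lt r (by rw [Finset.mem_range] at hr; omega)).symm
    _ = if q = 0 then 1 else 0 := hcoeff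

end GeneratingSeries

section Determinants

section Derivation

variable {R A ι : Type*} [CommRing R] [CommRing A] [Algebra R A] [DecidableEq ι]

theorem derivation_prod (D : Derivation R A A) (s : Finset ι) (f : ι → A) :
    D (∏ i ∈ s, f i) = ∑ r ∈ s, ∏ i ∈ s, if i = r then D (f i) else f i := by
  induction s using Finset.induction_on with
  | empty => simp
  | insert a s ha ih =>
    rw [Finset.prod_insert ha, Derivation.leibniz, ih, Finset.sum_insert ha, Finset.prod_insert ha,
      if_pos rfl, smul_eq_mul, smul_eq_mul, add_comm, Finset.mul_sum, mul_comm _ (D (f a))]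
    congr 1
    · exact congrArg _ <|
        Finset.prod_congr rfl fun i hi => by rw [if_neg (ne_of_mem_of_not_mem hi ha)]
    · exact Finset.sum_congr rfl fun r hr => by
        rw [Finset.prod_insert ha, if_neg (ne_of_mem_of_not_mem hr ha).symm]

theorem derivation_det [Fintype ι] (D : Derivation R A A) (M : Matrix ι ι A) :
    D M.det = ∑ r, (M.updateRow r fun j => D (M r j)).det := by
  have det_eq_sum_rows : ∀ M : Matrix ι ι A,
      M.det = ∑ σ : Equiv.Perm ι, Equiv.Perm.sign σ • ∏ i, M i (σ i) := fun M => by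
    rw [← Matrix.det_transpose, Matrix.det_apply]
    rfl
  simp only [det_eq_sum_rows, Units.smul_def, map_sum, map_zsmul, derivation_prod, Finset.smul_sum]
  rw [Finset.sum_comm]
  refine Finset.sum_congr rfl fun r _ => Finset.sum_congr rfl fun σ _ => ?_
  refine congrArg _ (Finset.prod_congr rfl fun i _ => ?_)
  rw [Matrix.updateRow_apply]
  split_ifs with hir
  · rw [hir]
  · rfl

end Derivation

theorem partialT_sum {ι : Type*} (I : List ℕ) (s : Finset ι) (F : ι → MvPolynomial ℕ ℂ) :
    partialT I (∑ r ∈ s, F r) = ∑ r ∈ s, partialT I (F r) := by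
  induction I with
  | nil => rfl
  | cons a I ih =>
    change MvPolynomial.pderiv a (partialT I (∑ r ∈ s, F r)) = _
    rw [ih, map_sum]
    rfl

theorem partialT_append_singleton (I : List ℕ) (a : ℕ) (F : MvPolynomial ℕ ℂ) :
    partialT (I ++ [a]) F = partialT I (MvPolynomial.pderiv a F) := by
  simp [partialT]

variable {k N : ℕ}

/-- The determinant `det (p_{β_r - (N - 1) + j})`, the Schur function indexed by beta-numbers
instead of parts: it is symmetric in the rows up to sign, and a derivative in `t_a` lowers one of
the `β_r` by `a`. -/
def betaDet (β : Fin N → ℤ) : MvPolynomial ℕ ℂ :=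
  Matrix.det (Matrix.of fun r j : Fin N => schurP (β r - ((N : ℤ) - 1) + (j : ℤ)))

/-- The beta-numbers `μ_{r+1} + N - 1 - r`, for `0 ≤ r < N`, of a sequence of parts `μ`. -/
def betaNumbers (N : ℕ) (μ : ℕ → ℕ) (r : Fin N) : ℤ :=
  μ r + ((N : ℤ) - 1) - r

theorem schur_eq_betaDet (l : ℕ) (μ : ℕ → ℕ) : schur l μ = betaDet (betaNumbers l μ) := by
  rw [schur, betaDet]
  congr
  ext1 r
  ext1 j
  rw [betaNumbers]
  congr 1
  ring

theorem betaDet_eq_zero_of_apply_eq {β : Fin N → ℤ} {r s : Fin N} (hrs : r ≠ s)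
    (h : β r = β s) : betaDet β = 0 :=
  Matrix.det_zero_of_row_eq hrs (by ext1 j; simp only [Matrix.of_apply, h])

theorem pderiv_betaDet (β : Fin N → ℤ) {a : ℕ} (ha : 0 < a) :
    MvPolynomial.pderiv a (betaDet β) = ∑ r, betaDet (Function.update β r (β r - a)) := by
  rw [betaDet, derivation_det]
  refine Finset.sum_congr rfl fun r _ => ?_
  rw [betaDet]
  congr 1
  ext1 i j
  simp only [Matrix.updateRow_apply, Matrix.of_apply, Function.update_apply]
  split_ifs
  · rw [pderiv_schurP ha]
    congr 1
    ring
  · rfl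

theorem partialT_append_singleton_betaDet (β : Fin N → ℤ) (I : List ℕ) {a : ℕ} (ha : 0 < a) :
    partialT (I ++ [a]) (betaDet β) =
      ∑ r, partialT I (betaDet (Function.update β r (β r - a))) := by
  rw [partialT_append_singleton, pderiv_betaDet β ha, partialT_sum]

/-- The unipotent matrix of the column operations which apply the recurrence of order `k` for the
values `p_n(∑ [x_i])` to all columns but the first `k`. -/
def columnReduction (x : Fin k → ℂ) (N : ℕ) : Matrix (Fin N) (Fin N) ℂ :=
  Matrix.of fun i j =>
    if (j : ℕ) < k then (if i = j then 1 else 0)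
    else if i ≤ j then (reciprocalPoly x).coeff ((j : ℕ) - i) else 0

theorem det_columnReduction (x : Fin k → ℂ) : (columnReduction x N).det = 1 := by
  rw [Matrix.det_of_isUpperTriangular]
  · exact Finset.prod_eq_one fun i _ => by simp [columnReduction, coeff_zero_reciprocalPoly]
  · intro i j hij
    have hij' : i > j := hij
    simp [columnReduction, not_le.mpr hij', hij'.ne']

theorem sum_eval_schurP_mul_columnReduction (x : Fin k → ℂ) (q : ℤ) {j : Fin N}
    (hj : k ≤ (j : ℕ)) :
    ∑ i : Fin N, MvPolynomial.eval (bracketSum x) (schurP (q + (i : ℤ))) * columnReduction x N i j =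
      if q = -(j : ℤ) then 1 else 0 := by
  have hrec := sum_coeff_reciprocalPoly_mul_eval_schurP x hj (q + j)
  simp only [← eq_neg_iff_add_eq_zero] at hrec
  rw [← hrec, ← Finset.sum_range_reflect]
  let F : ℕ → ℂ := fun i => if i ≤ (j : ℕ) then
    MvPolynomial.eval (bracketSum x) (schurP (q + (i : ℤ))) *
      (reciprocalPoly x).coeff ((j : ℕ) - i) else 0
  calc _ = ∑ i : Fin N, F i := by
        refine Finset.sum_congr rfl fun i _ => ?_
        simp only [F, columnReduction, Matrix.of_apply, not_lt.mpr hj, if_false, Fin.le_def,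
          mul_ite, mul_zero]
    _ = ∑ i ∈ Finset.range N, F i := Fin.sum_univ_eq_sum_range F N
    _ = ∑ i ∈ Finset.range ((j : ℕ) + 1), F i := by
        refine (Finset.sum_subset (Finset.range_mono (by omega)) fun i _ hi => if_neg ?_).symm
        rw [Finset.mem_range] at hi
        omega
    _ = _ := by
        refine Finset.sum_congr rfl fun i hi => ?_
        have hij : i ≤ (j : ℕ) := Nat.lt_succ_iff.mp (Finset.mem_range.mp hi)
        refine (if_pos hij).trans ?_
        rw [mul_comm, Nat.add_sub_cancel, Nat.cast_sub hij]
        congr 3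
        ring

theorem eval_betaDet (x : Fin k → ℂ) (β : Fin N → ℤ) :
    MvPolynomial.eval (bracketSum x) (betaDet β) =
      Matrix.det (Matrix.of fun r j : Fin N =>
        if (j : ℕ) < k then
          MvPolynomial.eval (bracketSum x) (schurP (β r - ((N : ℤ) - 1) + (j : ℤ)))
        else if β r = (N : ℤ) - 1 - j then 1 else 0) := by
  rw [betaDet, RingHom.map_det]
  have det_mul_columnReduction : ∀ M : Matrix (Fin N) (Fin N) ℂ,
      M.det = (M * columnReduction x N).det := fun M => by
    rw [Matrix.det_mul, det_columnReduction, mul_one]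
  rw [det_mul_columnReduction]
  congr 1
  ext1 r j
  rw [Matrix.mul_apply, Matrix.of_apply]
  by_cases hj : (j : ℕ) < k
  · simp [columnReduction, hj]
  · rw [if_neg hj]
    refine (sum_eval_schurP_mul_columnReduction x (β r - ((N : ℤ) - 1)) (not_lt.mp hj)).trans ?_
    exact if_congr (by omega) rfl rfl

/-- The number of entries of `β` which are at least `c`. Only the determinants with at most `k`
entries `≥ N - k` can be non-zero at a sum of `k` points. -/
def largeCount (c : ℤ) (β : Fin N → ℤ) : ℕ :=
  (Finset.univ.filter fun r => c ≤ β r).card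

theorem largeCount_le_largeCount_update (c : ℤ) (β : Fin N → ℤ) (r : Fin N) (v : ℤ) :
    largeCount c β ≤ largeCount c (Function.update β r v) + 1 := by
  refine le_trans (Finset.card_le_card (t := insert r
    (Finset.univ.filter fun s => c ≤ Function.update β r v s)) ?_) (Finset.card_insert_le _ _)
  intro s hs
  by_cases hsr : s = r
  · simp [hsr]
  · simpa [hsr, Function.update_of_ne] using hs

theorem largeCount_le_largeCount_update_of_imp {c : ℤ} {β : Fin N → ℤ} {r : Fin N} {v : ℤ}
    (h : c ≤ β r → c ≤ v) : largeCount c β ≤ largeCount c (Function.update β r v) := by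
  refine Finset.card_le_card fun s hs => ?_
  by_cases hsr : s = r
  · subst hsr
    simpa using h (by simpa using hs)
  · simpa [hsr, Function.update_of_ne] using hs

theorem le_largeCount_of_forall_lt {c : ℤ} {β : Fin N → ℤ} {m : ℕ} (hm : m ≤ N)
    (h : ∀ r : Fin N, (r : ℕ) < m → c ≤ β r) : m ≤ largeCount c β :=
  calc m = (Finset.univ.filter fun r : Fin N => (r : ℕ) < m).card := by
        rw [Fin.card_filter_val_lt, min_eq_right hm]
    _ ≤ largeCount c β := Finset.card_le_card fun r hr => by
        simp only [Finset.mem_filter, Finset.mem_univ, true_and] at hr ⊢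
        exact h r hr

/-- The large rows vanish off the first `k` columns, so more than `k` of them are dependent. -/
theorem eval_betaDet_eq_zero_of_lt_largeCount (x : Fin k → ℂ) {β : Fin N → ℤ}
    (h : k < largeCount ((N : ℤ) - k) β) :
    MvPolynomial.eval (bracketSum x) (betaDet β) = 0 := by
  rw [eval_betaDet, Matrix.det_apply]
  refine Finset.sum_eq_zero fun σ _ => ?_
  have hcard : ((Finset.univ.filter fun j : Fin N => (j : ℕ) < k).map σ.toEmbedding).card <
      largeCount ((N : ℤ) - k) β := by
    rw [Finset.card_map, Fin.card_filter_val_lt]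
    exact (min_le_right _ _).trans_lt h
  obtain ⟨r, hr, hrσ⟩ := Finset.exists_mem_notMem_of_card_lt_card hcard
  obtain ⟨j, rfl⟩ := σ.surjective r
  have hj : ¬ (j : ℕ) < k := fun hj => hrσ (by simpa using hj)
  have hβ : (N : ℤ) - k ≤ β (σ j) := by simpa using hr
  rw [Finset.prod_eq_zero (Finset.mem_univ j), smul_zero]
  rw [Matrix.of_apply, if_neg hj, if_neg (by omega)]

theorem eval_partialT_eq_zero_of_lt_largeCount (x : Fin k → ℂ) {I : List ℕ} (hI : ∀ i ∈ I, 0 < i)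
    {β : Fin N → ℤ} (h : k + I.length < largeCount ((N : ℤ) - k) β) :
    MvPolynomial.eval (bracketSum x) (partialT I (betaDet β)) = 0 := by
  induction I using List.reverseRecOn generalizing β with
  | nil => exact eval_betaDet_eq_zero_of_lt_largeCount x h
  | append_singleton I a ih =>
    rw [partialT_append_singleton_betaDet β I (hI a (by simp)), map_sum]
    refine Finset.sum_eq_zero fun r _ => ih (fun i hi => hI i (by simp [hi])) ?_
    have := largeCount_le_largeCount_update ((N : ℤ) - k) β r (β r - a)
    rw [List.length_append, List.length_singleton] at h
    omega

/-- Each derivative has to lower one of the large entries, so two equal small entries are never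
separated. -/
theorem eval_partialT_eq_zero_of_apply_eq (x : Fin k → ℂ) {I : List ℕ} (hI : ∀ i ∈ I, 0 < i)
    {β : Fin N → ℤ} (h : k + I.length ≤ largeCount ((N : ℤ) - k) β) {r s : Fin N} (hrs : r ≠ s)
    (heq : β r = β s) (hlt : β r < (N : ℤ) - k) :
    MvPolynomial.eval (bracketSum x) (partialT I (betaDet β)) = 0 := by
  induction I using List.reverseRecOn generalizing β with
  | nil =>
    change MvPolynomial.eval (bracketSum x) (betaDet β) = 0
    rw [betaDet_eq_zero_of_apply_eq hrs heq, map_zero]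
  | append_singleton I a ih =>
    have hI' : ∀ i ∈ I, 0 < i := fun i hi => hI i (by simp [hi])
    rw [List.length_append, List.length_singleton] at h
    rw [partialT_append_singleton_betaDet β I (hI a (by simp)), map_sum]
    refine Finset.sum_eq_zero fun q _ => ?_
    by_cases hq : β q < (N : ℤ) - k
    · refine eval_partialT_eq_zero_of_lt_largeCount x hI' ?_
      exact h.trans (largeCount_le_largeCount_update_of_imp (by omega))
    · have hrq : r ≠ q := by rintro rfl; exact hq hlt
      have hsq : s ≠ q := by rintro rfl; exact hq (heq ▸ hlt)
      refine ih hI' ?_ ?_ ?_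
      · have := largeCount_le_largeCount_update ((N : ℤ) - k) β q (β q - a)
        omega
      · rw [Function.update_of_ne hrq, Function.update_of_ne hsq, heq]
      · rwa [Function.update_of_ne hrq]

/-- If every large entry other than `β R` would collide with another entry on becoming small, the
derivative in `t_a` has to lower `β R`. -/
theorem eval_partialT_append_singleton_of_collision (x : Fin k → ℂ) {I : List ℕ}
    (hI : ∀ i ∈ I, 0 < i) {a : ℕ} (ha : 0 < a) {β : Fin N → ℤ}
    (h : k + I.length + 1 ≤ largeCount ((N : ℤ) - k) β) (R : Fin N)
    (hR : ∀ r ≠ R, (N : ℤ) - k ≤ β r → β r - a < (N : ℤ) - k → ∃ s ≠ r, β s = β r - a) :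
    MvPolynomial.eval (bracketSum x) (partialT (I ++ [a]) (betaDet β)) =
      MvPolynomial.eval (bracketSum x)
        (partialT I (betaDet (Function.update β R (β R - a)))) := by
  rw [partialT_append_singleton_betaDet β I ha, map_sum]
  refine Finset.sum_eq_single R (fun r _ hr => ?_) (by simp)
  by_cases hkeep : (N : ℤ) - k ≤ β r → (N : ℤ) - k ≤ β r - a
  · refine eval_partialT_eq_zero_of_lt_largeCount x hI ?_
    exact Nat.lt_of_succ_le (h.trans (largeCount_le_largeCount_update_of_imp hkeep))
  · rw [Classical.not_imp, not_le] at hkeep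
    obtain ⟨s, hsr, hs⟩ := hR r hr hkeep.1 hkeep.2
    refine eval_partialT_eq_zero_of_apply_eq x hI ?_ hsr.symm ?_ ?_
    · have := largeCount_le_largeCount_update ((N : ℤ) - k) β r (β r - a)
      omega
    · rw [Function.update_self, Function.update_of_ne hsr, hs]
    · rw [Function.update_self]
      exact hkeep.2

end Determinants

section LoweringRows

variable {k n m : ℕ}

/-- The rows `k, …, k + m - 1` of `β` are replaced by `c 0, …, c (m - 1)`. -/
def lowerRows (m : ℕ) (c : ℕ → ℕ) (β : Fin (k + n) → ℤ) (r : Fin (k + n)) : ℤ :=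
  if k ≤ (r : ℕ) ∧ (r : ℕ) < k + m then (c (r - k) : ℤ) else β r

theorem lowerRows_succ {c : ℕ → ℕ} {β : Fin (k + n) → ℤ} (hm : m < n) :
    lowerRows (m + 1) c β =
      lowerRows m c (Function.update β (Fin.natAdd k ⟨m, hm⟩) (c m)) := by
  ext1 r
  unfold lowerRows
  rcases eq_or_ne r (Fin.natAdd k ⟨m, hm⟩) with rfl | hr
  · simp
  · have hr' : (r : ℕ) ≠ k + m := fun h => hr (Fin.ext h)
    rw [Function.update_of_ne hr]
    exact if_congr (by omega) rfl rfl

/-- The situation in which derivatives can lower the rows `k, …, k + m - 1` of `β` to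
`c 0, …, c (m - 1)` in only one way: the first `k + m` entries of `β` are decreasing and `≥ n`, the
others are `< n`, and these others together with `c 0 < ⋯ < c (m - 1)` exhaust `0, …, n - 1`. -/
structure IsLowerable (m : ℕ) (β : Fin (k + n) → ℤ) (c : ℕ → ℕ) : Prop where
  le : m ≤ n
  strictMonoOn : StrictMonoOn c (Set.Iio m)
  lt : ∀ i < m, c i < n
  large : ∀ r : Fin (k + n), (r : ℕ) < k + m → (n : ℤ) ≤ β r
  small : ∀ r : Fin (k + n), k + m ≤ (r : ℕ) → β r < n
  anti : ∀ r s : Fin (k + n), r < s → (s : ℕ) < k + m → β s < β r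
  mem : ∀ v < n, (∀ i < m, v ≠ c i) → ∃ s : Fin (k + n), k + m ≤ (s : ℕ) ∧ β s = v

namespace IsLowerable

variable {β : Fin (k + n) → ℤ} {c : ℕ → ℕ}

theorem update (h : IsLowerable (m + 1) β c) :
    IsLowerable m (Function.update β (Fin.natAdd k ⟨m, h.le⟩) (c m)) c := by
  have ne_natAdd : ∀ r : Fin (k + n), (r : ℕ) ≠ k + m → r ≠ Fin.natAdd k ⟨m, h.le⟩ :=
    fun r hr hr' => hr (congrArg Fin.val hr')
  refine ⟨by have := h.le; omega, h.strictMonoOn.mono (Set.Iio_subset_Iio m.le_succ),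
    fun i hi => h.lt i (by omega), fun r hr => ?_, fun r hr => ?_, fun r s hrs hs => ?_,
    fun v hv hne => ?_⟩
  · rw [Function.update_of_ne (ne_natAdd r (by omega))]
    exact h.large r (by omega)
  · rcases eq_or_ne r (Fin.natAdd k ⟨m, h.le⟩) with rfl | hrR
    · rw [Function.update_self]
      exact_mod_cast h.lt m (by omega)
    · rw [Function.update_of_ne hrR]
      have : (r : ℕ) ≠ k + m := fun h => hrR (Fin.ext h)
      exact h.small r (by omega)
  · have := Fin.lt_def.mp hrs
    rw [Function.update_of_ne (ne_natAdd r (by omega)),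
      Function.update_of_ne (ne_natAdd s (by omega))]
    exact h.anti r s hrs (by omega)
  · rcases eq_or_ne v (c m) with rfl | hvm
    · exact ⟨Fin.natAdd k ⟨m, h.le⟩, by simp, by simp⟩
    · obtain ⟨s, hs, hsv⟩ := h.mem v hv fun i hi => by
        rcases Nat.lt_succ_iff_lt_or_eq.mp hi with hi | rfl
        · exact hne i hi
        · exact hvm
      exact ⟨s, by omega, by rwa [Function.update_of_ne (ne_natAdd s (by omega))]⟩

/-- A row above the last large one which the same derivative makes small ends above `c m`, hence
at an entry which already occurs. -/
theorem exists_apply_eq_of_lt (h : IsLowerable (m + 1) β c) {a : ℕ}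
    (ha : (a : ℤ) = β (Fin.natAdd k ⟨m, h.le⟩) - c m) {r : Fin (k + n)}
    (hr : r ≠ Fin.natAdd k ⟨m, h.le⟩) (hβr : (n : ℤ) ≤ β r) (hlt : β r - a < n) :
    ∃ s ≠ r, β s = β r - a := by
  have hrm : (r : ℕ) < k + m := by
    by_contra hge
    have hne : (r : ℕ) ≠ k + m := fun h => hr (Fin.ext h)
    have := h.small r (by omega)
    omega
  have hβR : β (Fin.natAdd k ⟨m, h.le⟩) < β r := h.anti r _ (Fin.lt_def.mpr hrm) (by simp)
  obtain ⟨v, hv⟩ : ∃ v : ℕ, (v : ℤ) = β r - a := ⟨(β r - a).toNat, by omega⟩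
  obtain ⟨s, hs, hsv⟩ := h.mem v (by omega) fun i hi => by
    have : c i ≤ c m := h.strictMonoOn.monotoneOn hi (Nat.lt_succ_self m) (by omega)
    omega
  exact ⟨s, fun hsr => by rw [hsr] at hs; omega, hsv.trans hv⟩

theorem eval_partialT_betaDet (x : Fin k → ℂ) (h : IsLowerable m β c) {a : ℕ → ℕ}
    (ha : ∀ i : Fin n, (i : ℕ) < m → (a i : ℤ) = β (Fin.natAdd k i) - c i) :
    MvPolynomial.eval (bracketSum x) (partialT ((List.range m).map a) (betaDet β)) =
      MvPolynomial.eval (bracketSum x) (betaDet (lowerRows m c β)) := by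
  induction m generalizing β with
  | zero =>
    change MvPolynomial.eval _ (betaDet β) = _
    congr 2
    ext1 r
    exact (if_neg (show ¬ (k ≤ (r : ℕ) ∧ (r : ℕ) < k + 0) by omega)).symm
  | succ m ih =>
    have hmn : m < n := h.le
    have hpos : ∀ i < m + 1, 0 < a i := fun i hi => by
      have hai := ha ⟨i, by omega⟩ hi
      have := h.large (Fin.natAdd k ⟨i, by omega⟩) (by simpa using hi)
      have := h.lt i hi
      simp only at hai
      omega
    have ham : (a m : ℤ) = β (Fin.natAdd k ⟨m, hmn⟩) - c m := ha ⟨m, hmn⟩ (Nat.lt_succ_self m)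
    have hlarge : k + (m + 1) ≤ largeCount (((k + n : ℕ) : ℤ) - k) β :=
      le_largeCount_of_forall_lt (by omega) fun r hr => by have := h.large r hr; omega
    rw [List.range_succ, List.map_append, List.map_singleton,
      eval_partialT_append_singleton_of_collision x (R := Fin.natAdd k ⟨m, hmn⟩)]
    · rw [show β (Fin.natAdd k ⟨m, hmn⟩) - a m = c m by omega, lowerRows_succ hmn]
      refine ih h.update fun i hi => ?_
      rw [Function.update_of_ne fun hi' => hi.ne (congrArg Fin.val ((Fin.natAdd_inj k).mp hi'))]
      exact ha i (by omega)
    · simp only [List.mem_map, List.mem_range]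
      rintro _ ⟨i, hi, rfl⟩
      exact hpos i (by omega)
    · exact hpos m (by omega)
    · simpa [add_assoc] using hlarge
    · exact fun r hr hβr hlt => h.exists_apply_eq_of_lt ham hr (by omega) (by omega)

end IsLowerable

theorem strictAnti_betaNumbers {N : ℕ} {μ : ℕ → ℕ} (hμ : Antitone μ) :
    StrictAnti (betaNumbers N μ) := fun r s hrs => by
  have hμrs : μ s ≤ μ r := hμ (Fin.le_def.mp hrs.le)
  have := Fin.lt_def.mp hrs
  simp only [betaNumbers]
  omega

/-- The matrix is block triangular, the lower right block being a permutation matrix. -/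
theorem eval_betaDet_of_perm (x : Fin k → ℂ) {μ : ℕ → ℕ} (τ : Equiv.Perm (Fin n))
    {β : Fin (k + n) → ℤ}
    (hupper : ∀ i : Fin k, β (Fin.castAdd n i) = betaNumbers (k + n) μ (Fin.castAdd n i))
    (hlower : ∀ i : Fin n, β (Fin.natAdd k i) = (τ i : ℕ)) :
    MvPolynomial.eval (bracketSum x) (betaDet β) =
      ((Equiv.Perm.sign (Fin.revPerm * τ) : ℤ) : ℂ) *
        MvPolynomial.eval (bracketSum x) (schur k μ) := by
  rw [eval_betaDet, ← Matrix.det_submatrix_equiv_self finSumFinEquiv,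
    ← Matrix.fromBlocks_toBlocks (Matrix.submatrix _ _ _)]
  rw [show Matrix.toBlocks₁₂ _ = 0 from ?_, Matrix.det_fromBlocks_zero₁₂, mul_comm]
  · congr 1
    · rw [← Matrix.det_permutation]
      congr 1
      ext i j
      have := (τ i).is_lt
      simp only [Matrix.toBlocks₂₂, Matrix.submatrix_apply, Matrix.of_apply,
        finSumFinEquiv_apply_right, Fin.val_natAdd, hlower, PEquiv.toMatrix_apply,
        Equiv.toPEquiv_apply, Option.mem_def, Option.some.injEq, Equiv.Perm.mul_apply,
        Fin.revPerm_apply, Fin.ext_iff, Fin.val_rev]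
      rw [if_neg (by omega)]
      congr 1
      rw [eq_iff_iff]
      omega
    · rw [schur, RingHom.map_det]
      congr 1
      ext i j
      simp only [Matrix.toBlocks₁₁, Matrix.submatrix_apply, Matrix.of_apply, betaNumbers,
        finSumFinEquiv_apply_left, Fin.val_castAdd, hupper, RingHom.mapMatrix_apply,
        Matrix.map_apply]
      rw [if_pos j.is_lt]
      congr 2
      ring
  · ext i j
    simp only [Matrix.toBlocks₁₂, Matrix.submatrix_apply, Matrix.of_apply, betaNumbers,
      finSumFinEquiv_apply_left, finSumFinEquiv_apply_right, Fin.val_natAdd, Fin.val_castAdd,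
      hupper, Matrix.zero_apply]
    rw [if_neg (by omega), if_neg (by omega)]

end LoweringRows

section GapSequences

variable (P : ℕ → Prop) [DecidablePred P]

variable {P} in
theorem lt_card_of_lt_count {i N : ℕ} (h : i < Nat.count P N) (hf : {v | P v}.Finite) :
    i < hf.toFinset.card :=
  h.trans_le (Nat.count_le_card hf N)

variable {P} in
theorem le_nth_of_count_le {j n N : ℕ} (hj : j < Nat.count P N) (h : Nat.count P n ≤ j) :
    n ≤ Nat.nth P j := by
  by_contra! hlt
  have hcount := Nat.count_strict_mono (p := P) (Nat.nth_mem j (lt_card_of_lt_count hj)) hlt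
  rw [Nat.count_nth (lt_card_of_lt_count hj)] at hcount
  omega

theorem count_add_count_not (n : ℕ) : Nat.count P n + Nat.count (fun v => ¬ P v) n = n := by
  induction n with
  | zero => simp
  | succ n ih =>
    rw [Nat.count_succ, Nat.count_succ]
    split_ifs <;> omega

/-- The sequence of the elements of `P` below `n` in increasing order, followed by the elements
below `n` of the complement in decreasing order. -/
def gapRow (n i : ℕ) : ℕ :=
  if i < Nat.count P n then Nat.nth P i else Nat.nth (fun v => ¬ P v) (n - 1 - i)

variable {n : ℕ}

theorem gapRow_lt (i : Fin n) : gapRow P n i < n := by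
  have := count_add_count_not P n
  rw [gapRow]
  split_ifs with hi
  · exact Nat.nth_lt_of_lt_count hi
  · exact Nat.nth_lt_of_lt_count (by omega)

theorem gapRow_injective : Function.Injective fun i : Fin n => gapRow P n i := by
  intro i j hij
  have := count_add_count_not P n
  have nth_mem_of_lt : ∀ {i}, i < Nat.count P n → P (Nat.nth P i) := fun hi =>
    Nat.nth_mem _ (lt_card_of_lt_count hi)
  have lt_count_not : ∀ {i : Fin n}, ¬ (i : ℕ) < Nat.count P n →
      n - 1 - i < Nat.count (fun v => ¬ P v) n := fun hi => by omega
  have nth_not_mem : ∀ {i : Fin n}, ¬ (i : ℕ) < Nat.count P n →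
      ¬ P (Nat.nth (fun v => ¬ P v) (n - 1 - i)) := fun hi =>
    Nat.nth_mem (p := fun v => ¬ P v) _ (lt_card_of_lt_count (lt_count_not hi))
  simp only [gapRow] at hij
  split_ifs at hij with hi hj hj
  · rw [← Fin.val_inj, ← Nat.count_nth (lt_card_of_lt_count hi), hij,
      Nat.count_nth (lt_card_of_lt_count hj)]
  · exact absurd (hij ▸ nth_mem_of_lt hi) (nth_not_mem hj)
  · exact absurd (hij ▸ nth_mem_of_lt hj) (nth_not_mem hi)
  · have hcount := Nat.count_nth (lt_card_of_lt_count (lt_count_not hi))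
    rw [hij, Nat.count_nth (lt_card_of_lt_count (lt_count_not hj))] at hcount
    omega

/-- The permutation `i ↦ gapRow P n i` of `{0, …, n - 1}`. -/
def gapRowPerm (n : ℕ) : Equiv.Perm (Fin n) :=
  Equiv.ofBijective (fun i => ⟨gapRow P n i, gapRow_lt P i⟩)
    (Finite.injective_iff_bijective.mp fun _ _ hij =>
      gapRow_injective P (congrArg Fin.val hij))

/-- The permutation given in two-line notation by the rows `gapRow P n` and `n - 1, …, 1, 0`. -/
def gapPerm (n : ℕ) : Equiv.Perm (Fin n) :=
  (Fin.revPerm.trans (gapRowPerm P n)).symm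

theorem gapPerm_symm_rev (i : Fin n) : ((gapPerm P n).symm (Fin.rev i) : ℕ) = gapRow P n i := by
  simp [gapPerm, gapRowPerm]

theorem sign_gapPerm (n : ℕ) :
    Equiv.Perm.sign (gapPerm P n) = Equiv.Perm.sign (Fin.revPerm * gapRowPerm P n) := by
  rw [show gapPerm P n = (gapRowPerm P n * Fin.revPerm)⁻¹ from rfl, Equiv.Perm.sign_inv,
    Equiv.Perm.sign_mul, Equiv.Perm.sign_mul, mul_comm]

variable {k M : ℕ} {μ : ℕ → ℕ} {P}

theorem betaNumbers_natAdd (h : n ≤ Nat.count (fun v => ¬ P v) M)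
    (hμ : ∀ i < n, μ (k + i) = Nat.nth (fun v => ¬ P v) (n - 1 - i) - (n - 1 - i)) (i : Fin n) :
    betaNumbers (k + n) μ (Fin.natAdd k i) = Nat.nth (fun v => ¬ P v) (n - 1 - i) := by
  have := Nat.le_nth (p := fun v => ¬ P v) (n := n - 1 - i)
    (lt_card_of_lt_count (N := M) (by omega))
  rw [betaNumbers, Fin.val_natAdd, hμ i i.is_lt]
  push_cast
  omega

theorem isLowerable_betaNumbers (h : n ≤ Nat.count (fun v => ¬ P v) M) (hanti : Antitone μ)
    (hμ : ∀ i < n, μ (k + i) = Nat.nth (fun v => ¬ P v) (n - 1 - i) - (n - 1 - i)) :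
    IsLowerable (Nat.count P n) (betaNumbers (k + n) μ) (Nat.nth P) := by
  have hcount := count_add_count_not P n
  have lower_row : ∀ r : Fin (k + n), k ≤ (r : ℕ) → ∃ i : Fin n, r = Fin.natAdd k i :=
    fun r hr => ⟨⟨r - k, by omega⟩, Fin.ext (by simp [hr])⟩
  refine ⟨by omega, fun i _ j hj hij => ?_, fun i hi => Nat.nth_lt_of_lt_count hi, fun r hr => ?_,
    fun r hr => ?_, fun r s hrs _ => strictAnti_betaNumbers hanti hrs, fun v hv hne => ?_⟩
  · exact Nat.nth_lt_nth' hij (lt_card_of_lt_count hj)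
  · rcases lt_or_ge (r : ℕ) k with hrk | hrk
    · rw [betaNumbers]
      push_cast
      omega
    · obtain ⟨i, rfl⟩ := lower_row r hrk
      rw [Fin.val_natAdd] at hr
      rw [betaNumbers_natAdd h hμ]
      exact_mod_cast le_nth_of_count_le (N := M) (by omega) (by omega)
  · obtain ⟨i, rfl⟩ := lower_row r (by omega)
    rw [Fin.val_natAdd] at hr
    rw [betaNumbers_natAdd h hμ]
    exact_mod_cast Nat.nth_lt_of_lt_count (by omega)
  · have hPv : ¬ P v := fun hPv => hne _ (Nat.count_strict_mono hPv hv) (Nat.nth_count hPv).symm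
    have hlt : Nat.count (fun v => ¬ P v) v < Nat.count (fun v => ¬ P v) n :=
      Nat.count_strict_mono hPv hv
    refine ⟨Fin.natAdd k ⟨n - 1 - Nat.count (fun v => ¬ P v) v, by omega⟩, ?_, ?_⟩
    · simp only [Fin.val_natAdd]
      omega
    · rw [betaNumbers_natAdd h hμ]
      simp only
      rw [show n - 1 - (n - 1 - Nat.count (fun v => ¬ P v) v) = Nat.count (fun v => ¬ P v) v by
        omega, Nat.nth_count (p := fun v => ¬ P v) hPv]

theorem eval_partialT_schur (h : n ≤ Nat.count (fun v => ¬ P v) M) (hanti : Antitone μ)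
    (hμ : ∀ i < n, μ (k + i) = Nat.nth (fun v => ¬ P v) (n - 1 - i) - (n - 1 - i))
    (x : Fin k → ℂ) :
    MvPolynomial.eval (bracketSum x)
        (partialT ((List.range (Nat.count P n)).map fun i =>
          Nat.nth (fun v => ¬ P v) (n - 1 - i) - Nat.nth P i) (schur (k + n) μ)) =
      ((Equiv.Perm.sign (gapPerm P n) : ℤ) : ℂ) * MvPolynomial.eval (bracketSum x) (schur k μ) := by
  have hlow := isLowerable_betaNumbers h hanti hμ
  rw [schur_eq_betaDet, hlow.eval_partialT_betaDet x, sign_gapPerm]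
  · refine eval_betaDet_of_perm x (gapRowPerm P n) (fun i => ?_) fun i => ?_
    · exact if_neg (by rw [Fin.val_castAdd]; omega)
    · rw [lowerRows, Fin.val_natAdd, betaNumbers_natAdd h hμ, Nat.add_sub_cancel_left,
        show ((gapRowPerm P n i : Fin n) : ℕ) = gapRow P n i from rfl, gapRow, Nat.cast_ite]
      exact if_congr (by omega) rfl rfl
  · intro i hi
    have hge := hlow.large (Fin.natAdd k i) (by simpa using hi)
    have := hlow.lt i hi
    rw [betaNumbers_natAdd h hμ] at hge ⊢
    omega

end GapSequences

section SchurFunctions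

theorem schur_succ {l : ℕ} {μ : ℕ → ℕ} (h : μ l = 0) : schur (l + 1) μ = schur l μ := by
  rw [schur, Matrix.det_succ_row _ (Fin.last l), Finset.sum_eq_single (Fin.last l)]
  · simp only [Matrix.of_apply, Fin.val_last, h, Nat.cast_zero, zero_sub, neg_add_cancel,
      schurP_zero, mul_one, Fin.succAbove_last, ← two_mul, pow_mul, neg_one_sq, one_pow, one_mul]
    rfl
  · intro j _ hj
    have hjl : (j : ℕ) < l := Fin.val_lt_last hj
    rw [Matrix.of_apply, Fin.val_last, h, schurP_of_neg (by omega), mul_zero, zero_mul]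
  · simp

theorem schur_add {l : ℕ} {μ : ℕ → ℕ} (h : ∀ i, l ≤ i → μ i = 0) (d : ℕ) :
    schur (l + d) μ = schur l μ := by
  induction d with
  | zero => rfl
  | succ d ih => rw [← add_assoc, schur_succ (h _ (by omega)), ih]

theorem schur_congr_length {l l' : ℕ} {μ : ℕ → ℕ} (h : ∀ i, l ≤ i → μ i = 0)
    (h' : ∀ i, l' ≤ i → μ i = 0) : schur l μ = schur l' μ := by
  rw [← schur_add h l', ← schur_add h' l, add_comm]

theorem bracketSum_of_isEmpty (x : Fin 0 → ℂ) : bracketSum x = 0 := by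
  ext n
  simp [bracketSum]

theorem eval_zero_betaDet {N : ℕ} {β : Fin N → ℤ} (h : ∑ r, β r ≠ ∑ r : Fin N, (r : ℤ)) :
    MvPolynomial.eval (0 : ℕ → ℂ) (betaDet β) = 0 := by
  rw [← bracketSum_of_isEmpty Fin.elim0, eval_betaDet, Matrix.det_apply]
  refine Finset.sum_eq_zero fun σ _ => ?_
  obtain ⟨j, hj⟩ : ∃ j, β (σ j) ≠ (Fin.rev j : ℕ) := by
    by_contra! hσ
    refine h ?_
    rw [← Equiv.sum_comp σ β, ← Equiv.sum_comp Fin.revPerm fun r : Fin N => ((r : ℕ) : ℤ)]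
    exact Finset.sum_congr rfl fun j _ => hσ j
  rw [Fin.val_rev] at hj
  rw [Finset.prod_eq_zero (Finset.mem_univ j), smul_zero]
  rw [Matrix.of_apply, if_neg (Nat.not_lt_zero _), if_neg (by omega)]

theorem eval_zero_partialT_betaDet {N : ℕ} {β : Fin N → ℤ} {I : List ℕ} (hI : ∀ i ∈ I, 0 < i)
    (h : ∑ r, β r ≠ ∑ r : Fin N, (r : ℤ) + I.sum) :
    MvPolynomial.eval (0 : ℕ → ℂ) (partialT I (betaDet β)) = 0 := by
  induction I using List.reverseRecOn generalizing β with
  | nil => exact eval_zero_betaDet (by simpa using h)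
  | append_singleton I a ih =>
    rw [partialT_append_singleton_betaDet β I (hI a (by simp)), map_sum]
    refine Finset.sum_eq_zero fun r _ => ih (fun i hi => hI i (by simp [hi])) fun hsum => h ?_
    rw [Finset.sum_update_of_mem (Finset.mem_univ r)] at hsum
    rw [← Finset.add_sum_erase _ _ (Finset.mem_univ r), ← Finset.sdiff_singleton_eq_erase,
      List.sum_append, List.sum_singleton, Nat.cast_add]
    linarith

theorem sum_betaNumbers (l : ℕ) (μ : ℕ → ℕ) :
    ∑ r, betaNumbers l μ r = ∑ r : Fin l, (r : ℤ) + ∑ i ∈ Finset.range l, (μ i : ℤ) := by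
  have hrev : ∑ r : Fin l, (((l : ℤ) - 1) - r) = ∑ r : Fin l, (r : ℤ) := by
    rw [← Equiv.sum_comp Fin.revPerm fun r : Fin l => ((r : ℕ) : ℤ)]
    refine Finset.sum_congr rfl fun r _ => ?_
    rw [Fin.revPerm_apply, Fin.val_rev]
    omega
  simp only [betaNumbers, add_sub_assoc]
  rw [Finset.sum_add_distrib, hrev, Fin.sum_univ_eq_sum_range fun i => ((μ i : ℕ) : ℤ), add_comm]

theorem eval_zero_partialT_schur_of_sum_ne {l : ℕ} {μ : ℕ → ℕ} {I : List ℕ}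
    (hI : ∀ i ∈ I, 0 < i) (h : I.sum ≠ ∑ i ∈ Finset.range l, μ i) :
    MvPolynomial.eval (0 : ℕ → ℂ) (partialT I (schur l μ)) = 0 := by
  rw [schur_eq_betaDet]
  refine eval_zero_partialT_betaDet hI fun hsum => h ?_
  rw [sum_betaNumbers, add_right_inj] at hsum
  exact_mod_cast hsum.symm

theorem eval_zero_partialT_schur_of_length_lt {l : ℕ} {μ : ℕ → ℕ} {I : List ℕ} {m : ℕ}
    (hI : ∀ i ∈ I, 0 < i) (hIm : I.length < m) (hml : m ≤ l) (hm : ∀ i < m, i < μ i) :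
    MvPolynomial.eval (0 : ℕ → ℂ) (partialT I (schur l μ)) = 0 := by
  rw [← bracketSum_of_isEmpty Fin.elim0, schur_eq_betaDet]
  refine eval_partialT_eq_zero_of_lt_largeCount _ hI ?_
  rw [zero_add]
  refine hIm.trans_le (le_largeCount_of_forall_lt hml fun r hr => ?_)
  have := hm r hr
  rw [betaNumbers]
  omega

end SchurFunctions

section Plane

open MeasureTheory Complex

/-- The antiholomorphic derivative `∂u/∂x + i ∂u/∂y` (twice the usual `∂̄ u`). -/
def dbar (u : ℂ → ℂ) (z : ℂ) : ℂ := fderiv ℝ u z 1 + I * fderiv ℝ u z I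

theorem dbar_congr {u v : ℂ → ℂ} {z : ℂ} (h : u =ᶠ[𝓝 z] v) : dbar u z = dbar v z := by
  rw [dbar, dbar, h.fderiv_eq]

theorem dbar_eq_zero_of_eventually_const {u : ℂ → ℂ} {z c : ℂ} (h : ∀ᶠ w in 𝓝 z, u w = c) :
    dbar u z = 0 := by
  rw [dbar_congr (v := fun _ => c) h]
  simp [dbar]

theorem dbar_of_differentiableAt {u : ℂ → ℂ} {z : ℂ} (h : DifferentiableAt ℂ u z) :
    dbar u z = 0 := by
  rw [dbar, h.fderiv_restrictScalars ℝ]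
  have : fderiv ℂ u z I = I * fderiv ℂ u z 1 := by
    simpa only [smul_eq_mul, mul_one] using (fderiv ℂ u z).map_smul I 1
  rw [ContinuousLinearMap.coe_restrictScalars', this, ← mul_assoc, I_mul_I]
  ring

theorem dbar_mul {u v : ℂ → ℂ} {z : ℂ} (hu : DifferentiableAt ℝ u z)
    (hv : DifferentiableAt ℝ v z) :
    dbar (fun w => u w * v w) z = dbar u z * v z + u z * dbar v z := by
  rw [dbar, dbar, dbar, show (fun w => u w * v w) = u * v from rfl, fderiv_mul hu hv]
  simp only [add_apply, smul_apply, smul_eq_mul]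
  ring

theorem dbar_sub {u v : ℂ → ℂ} {z : ℂ} (hu : DifferentiableAt ℝ u z)
    (hv : DifferentiableAt ℝ v z) :
    dbar (fun w => u w - v w) z = dbar u z - dbar v z := by
  rw [dbar, dbar, dbar, show (fun w => u w - v w) = u - v from rfl, fderiv_sub hu hv]
  simp only [sub_apply]
  ring

theorem dbar_sum {ι : Type*} {s : Finset ι} {u : ι → ℂ → ℂ} {z : ℂ}
    (hu : ∀ i ∈ s, DifferentiableAt ℝ (u i) z) :
    dbar (fun w => ∑ i ∈ s, u i w) z = ∑ i ∈ s, dbar (u i) z := by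
  simp only [dbar]
  rw [fderiv_fun_sum hu, Finset.sum_add_distrib, sum_apply,
    sum_apply, Finset.mul_sum]

theorem dbar_comp {u τ : ℂ → ℂ} {z : ℂ} (hu : DifferentiableAt ℝ u (τ z))
    (hτ : DifferentiableAt ℂ τ z) :
    dbar (fun w => u (τ w)) z = (starRingEnd ℂ) (deriv τ z) * dbar u (τ z) := by
  have hc := fderiv_comp z hu (hτ.restrictScalars ℝ)
  rw [hτ.fderiv_restrictScalars ℝ] at hc
  rw [dbar, dbar, show (fun w => u (τ w)) = u ∘ τ from rfl, hc]
  set L := fderiv ℝ u (τ z)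
  have hone : fderiv ℂ τ z 1 = deriv τ z := fderiv_apply_one_eq_deriv
  have hI : fderiv ℂ τ z I = I * deriv τ z := by
    simpa only [smul_eq_mul, mul_one, hone] using (fderiv ℂ τ z).map_smul I 1
  simp only [ContinuousLinearMap.comp_apply, ContinuousLinearMap.coe_restrictScalars', hone, hI]
  set a := deriv τ z
  have hL : ∀ w : ℂ, L w = w.re * L 1 + w.im * L I := by
    intro w
    have : w = w.re • (1 : ℂ) + w.im • I := by
      simp [Complex.re_add_im]
    conv_lhs => rw [this]
    rw [map_add, map_smul, map_smul, Complex.real_smul, Complex.real_smul]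
  rw [hL a, hL (I * a)]
  simp only [mul_re, I_re, zero_mul, I_im, one_mul, zero_sub, mul_im, zero_add, ofReal_neg]
  have hconj : (starRingEnd ℂ) a = a.re - a.im * I := by
    apply Complex.ext <;> simp
  rw [hconj]
  linear_combination (a.im * L I) * I_mul_I

theorem continuousAt_dbar {u : ℂ → ℂ} {z : ℂ} (hu : ContDiffAt ℝ 1 u z) :
    ContinuousAt (dbar u) z := by
  have h : ContinuousAt (fderiv ℝ u) z := hu.continuousAt_fderiv one_ne_zero
  exact (h.clm_apply continuousAt_const).add
    (continuousAt_const.mul (h.clm_apply continuousAt_const))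

theorem tsupport_dbar_subset (u : ℂ → ℂ) : tsupport (dbar u) ⊆ tsupport u := by
  refine closure_minimal (fun z hz => ?_) (isClosed_tsupport u)
  by_contra hzu
  refine hz (dbar_eq_zero_of_eventually_const (c := 0) ?_)
  exact notMem_tsupport_iff_eventuallyEq.mp hzu

theorem notMem_tsupport_dbar {u : ℂ → ℂ} {z c : ℂ} (h : ∀ᶠ w in 𝓝 z, u w = c) :
    z ∉ tsupport (dbar u) := by
  rw [notMem_tsupport_iff_eventuallyEq]
  filter_upwards [eventually_eventually_nhds.mpr h] with w hw
  exact dbar_eq_zero_of_eventually_const hw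

theorem integral_dbar_eq_zero {u : ℂ → ℂ} (hu : ContDiff ℝ 1 u) (hc : HasCompactSupport u) :
    ∫ z, dbar u z = 0 := by
  have hcont : Continuous (fderiv ℝ u) := hu.continuous_fderiv one_ne_zero
  have hInt : ∀ v : ℂ, Integrable fun z => fderiv ℝ u z v := fun v =>
    (hcont.clm_apply continuous_const).integrable_of_hasCompactSupport
      (hc.fderiv_apply (𝕜 := ℝ) v)
  have hzero : ∀ v : ℂ, ∫ z, fderiv ℝ u z v = 0 := by
    intro v
    have h := integral_mul_fderiv_eq_neg_fderiv_mul_of_integrable (μ := volume) (𝕜 := ℂ)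
      (f := fun _ : ℂ => (1 : ℂ)) (g := u) (v := v) (by simp)
      (by simpa using hInt v)
      (by simpa using hu.continuous.integrable_of_hasCompactSupport hc)
      (fun x _ => differentiableAt_const _)
      (fun x _ => hu.differentiable one_ne_zero x)
    simpa using h
  simp only [dbar]
  rw [integral_add (hInt 1) ((hInt I).const_mul I), integral_const_mul, hzero, hzero]
  simp

theorem continuous_dbar_mul {ψ h : ℂ → ℂ} (hψ : ContDiff ℝ 1 ψ)
    (hh : ∀ z ∈ tsupport (dbar ψ), ContinuousAt h z) :
    Continuous fun z => dbar ψ z * h z := by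
  rw [continuous_iff_continuousAt]
  intro z
  by_cases hz : z ∈ tsupport (dbar ψ)
  · exact (continuousAt_dbar hψ.contDiffAt).mul (hh z hz)
  · have : (fun z => dbar ψ z * h z) =ᶠ[𝓝 z] fun _ => 0 := by
      filter_upwards [notMem_tsupport_iff_eventuallyEq.mp hz] with w hw
      rw [hw]
      simp
    exact continuousAt_const.congr this.symm

theorem integrable_dbar_mul {ψ h : ℂ → ℂ} (hψ : ContDiff ℝ 1 ψ) (hc : HasCompactSupport ψ)
    (hh : ∀ z ∈ tsupport (dbar ψ), ContinuousAt h z) :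
    Integrable fun z => dbar ψ z * h z := by
  refine (continuous_dbar_mul hψ hh).integrable_of_hasCompactSupport ?_
  exact HasCompactSupport.mul_right (hc.mono' (subset_closure.trans (tsupport_dbar_subset ψ)))

theorem integral_dbar_mul_eq_zero {ψ η : ℂ → ℂ} (hψ : ContDiff ℝ 1 ψ) (hc : HasCompactSupport ψ)
    (hη : ∀ z ∈ tsupport ψ, AnalyticAt ℂ η z) : ∫ z, dbar ψ z * η z = 0 := by
  have hlocal : ∀ z, z ∉ tsupport ψ → (fun w => ψ w * η w) =ᶠ[𝓝 z] fun _ => 0 := by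
    intro z hz
    filter_upwards [notMem_tsupport_iff_eventuallyEq.mp hz] with w hw
    rw [hw]
    simp
  have hu : ContDiff ℝ 1 fun w => ψ w * η w := by
    rw [contDiff_iff_contDiffAt]
    intro z
    by_cases hz : z ∈ tsupport ψ
    · exact hψ.contDiffAt.mul ((hη z hz).contDiffAt.restrict_scalars ℝ)
    · exact contDiffAt_const.congr_of_eventuallyEq (hlocal z hz)
  have hdbar : ∀ z, dbar (fun w => ψ w * η w) z = dbar ψ z * η z := by
    intro z
    by_cases hz : z ∈ tsupport ψ
    · have hd := (hη z hz).differentiableAt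
      rw [dbar_mul (hψ.differentiable one_ne_zero z) (hd.restrictScalars ℝ),
        dbar_of_differentiableAt hd, mul_zero, add_zero]
    · rw [dbar_eq_zero_of_eventually_const (hlocal z hz), dbar_eq_zero_of_eventually_const
        (notMem_tsupport_iff_eventuallyEq.mp hz), zero_mul]
  rw [← integral_dbar_eq_zero hu hc.mul_right]
  exact integral_congr_ae (Filter.Eventually.of_forall fun z => (hdbar z).symm)

/-- A radial cutoff function in the plane, equal to `1` near `0`. It is made from
`Real.smoothTransition` so that `∫ ∂̄χ / z` becomes an integral of a function of constant sign. -/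
def cutoff (z : ℂ) : ℂ := (Real.smoothTransition (2 - normSq z) : ℝ)

theorem contDiff_normSq : ContDiff ℝ 1 normSq := by
  have : (normSq : ℂ → ℝ) = fun z => z.re * z.re + z.im * z.im := by
    ext z; exact normSq_apply z
  rw [this]
  exact (reCLM.contDiff.mul reCLM.contDiff).add (imCLM.contDiff.mul imCLM.contDiff)

theorem contDiff_cutoff : ContDiff ℝ 1 cutoff :=
  ofRealCLM.contDiff.comp
    ((Real.smoothTransition.contDiff (n := 1)).comp (contDiff_const.sub contDiff_normSq))

theorem cutoff_eventually_eq_one : ∀ᶠ z in 𝓝 (0 : ℂ), cutoff z = 1 := by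
  have : ∀ᶠ z : ℂ in 𝓝 0, normSq z < 1 :=
    (continuous_normSq.tendsto 0).eventually_lt_const (by simp)
  filter_upwards [this] with z hz
  rw [cutoff, Real.smoothTransition.one_of_one_le (by linarith), ofReal_one]

theorem hasCompactSupport_cutoff : HasCompactSupport cutoff := by
  refine HasCompactSupport.intro (isCompact_closedBall (0 : ℂ) 2) fun z hz => ?_
  have hnorm : 2 < ‖z‖ := by simpa using hz
  rw [cutoff, Real.smoothTransition.zero_of_nonpos, ofReal_zero]
  rw [normSq_eq_norm_sq]
  nlinarith

/-- The integral `∫ ∂̄χ / z`, which is the same for every compactly supported `χ` equal to `1` near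
`0`. Its value `-2π` is not needed, only that it is not zero. -/
def resConst : ℂ := ∫ z, dbar cutoff z * z⁻¹

theorem dbar_cutoff (z : ℂ) :
    dbar cutoff z = -2 * (deriv Real.smoothTransition (2 - normSq z) : ℝ) * z := by
  have hN : HasFDerivAt (fun z : ℂ => 2 - normSq z)
      (-((z.re • reCLM + z.re • reCLM) + (z.im • imCLM + z.im • imCLM))) z := by
    have h := ((reCLM.hasFDerivAt (x := z)).mul (reCLM.hasFDerivAt (x := z))).add
      ((imCLM.hasFDerivAt (x := z)).mul (imCLM.hasFDerivAt (x := z)))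
    have h' := h.const_sub 2
    exact h'.congr_of_eventuallyEq (Filter.Eventually.of_forall fun w => by simp [normSq_apply])
  have hs : HasDerivAt Real.smoothTransition
      (deriv Real.smoothTransition (2 - normSq z)) (2 - normSq z) :=
    ((Real.smoothTransition.contDiff (n := 1)).differentiable one_ne_zero _).hasDerivAt
  have h := ofRealCLM.hasFDerivAt.comp z (hs.comp_hasFDerivAt z hN)
  have h' : HasFDerivAt cutoff _ z := h
  rw [dbar, h'.fderiv]
  simp only [ContinuousLinearMap.comp_apply, smul_apply,
    neg_apply, add_apply, reCLM_apply, imCLM_apply,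
    ofRealCLM_apply, one_re, one_im, I_re, I_im, smul_eq_mul]
  generalize deriv Real.smoothTransition (2 - normSq z) = d
  conv_rhs => rw [← re_add_im z]
  push_cast
  ring

theorem deriv_smoothTransition_of_one_lt {t : ℝ} (ht : 1 < t) :
    deriv Real.smoothTransition t = 0 := by
  have hconst : Real.smoothTransition =ᶠ[𝓝 t] fun _ => 1 := by
    filter_upwards [lt_mem_nhds ht] with w hw
    exact Real.smoothTransition.one_of_one_le hw.le
  rw [hconst.deriv_eq, deriv_const]

theorem deriv_smoothTransition_of_neg {t : ℝ} (ht : t < 0) :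
    deriv Real.smoothTransition t = 0 := by
  have hconst : Real.smoothTransition =ᶠ[𝓝 t] fun _ => 0 := by
    filter_upwards [gt_mem_nhds ht] with w hw
    exact Real.smoothTransition.zero_of_nonpos (le_of_lt hw)
  rw [hconst.deriv_eq, deriv_const]

theorem exists_deriv_smoothTransition_eq_one :
    ∃ t ∈ Set.Ioo (0 : ℝ) 1, deriv Real.smoothTransition t = 1 := by
  have hdiff : Differentiable ℝ Real.smoothTransition :=
    (Real.smoothTransition.contDiff (n := 1)).differentiable one_ne_zero
  simpa using exists_deriv_eq_slope Real.smoothTransition zero_lt_one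
    Real.smoothTransition.continuous.continuousOn hdiff.differentiableOn

theorem resConst_eq :
    resConst = ((-2 * ∫ z : ℂ, deriv Real.smoothTransition (2 - normSq z) : ℝ) : ℂ) := by
  rw [resConst]
  push_cast
  rw [← integral_complex_ofReal, ← integral_const_mul]
  congr 1
  ext z
  rw [dbar_cutoff]
  by_cases hz : z = 0
  · simp [hz, deriv_smoothTransition_of_one_lt one_lt_two]
  · rw [mul_assoc, mul_inv_cancel₀ hz, mul_one]

theorem resConst_ne_zero : resConst ≠ 0 := by
  obtain ⟨t, ht, ht'⟩ := exists_deriv_smoothTransition_eq_one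
  have hcont : Continuous (deriv Real.smoothTransition) :=
    (Real.smoothTransition.contDiff (n := 1)).continuous_deriv le_rfl
  have hpos : 0 < ∫ z : ℂ, deriv Real.smoothTransition (2 - normSq z) := by
    refine Continuous.integral_pos_of_hasCompactSupport_nonneg_nonzero
      (x := ((Real.sqrt (2 - t) : ℝ) : ℂ)) (hcont.comp (continuous_const.sub continuous_normSq))
      ?_ (fun z => Real.smoothTransition.monotone.deriv_nonneg) ?_
    · refine HasCompactSupport.intro (isCompact_closedBall (0 : ℂ) 2) fun z hz => ?_
      have hnorm : 2 < ‖z‖ := by simpa using hz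
      apply deriv_smoothTransition_of_neg
      rw [normSq_eq_norm_sq]
      nlinarith
    · rw [normSq_ofReal, Real.mul_self_sqrt (by linarith [ht.2]), sub_sub_cancel, ht']
      exact one_ne_zero
  rw [resConst_eq]
  exact_mod_cast (by linarith : -2 * ∫ z : ℂ, deriv Real.smoothTransition (2 - normSq z) < 0).ne

theorem analyticAt_inv_sub {z z₀ : ℂ} (hz : z ≠ z₀) : AnalyticAt ℂ (fun w => (w - z₀)⁻¹) z :=
  (analyticAt_id.sub analyticAt_const).inv (sub_ne_zero.mpr hz)

theorem integrable_dbar_mul_inv_sub {ψ : ℂ → ℂ} {z₀ c : ℂ} (hψ : ContDiff ℝ 1 ψ)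
    (hc : HasCompactSupport ψ) (hconst : ∀ᶠ z in 𝓝 z₀, ψ z = c) :
    Integrable fun z => dbar ψ z * (z - z₀)⁻¹ :=
  integrable_dbar_mul hψ hc fun z hz => ContinuousAt.inv₀ (by fun_prop) <| sub_ne_zero.mpr <| by
    rintro rfl
    exact notMem_tsupport_dbar hconst hz

/-- The difference of two functions equal to `1` near `z₀` vanishes near the pole. -/
theorem integral_dbar_mul_inv_sub_congr {ψ χ : ℂ → ℂ} {z₀ : ℂ} (hψ : ContDiff ℝ 1 ψ)
    (hψc : HasCompactSupport ψ) (hψ1 : ∀ᶠ z in 𝓝 z₀, ψ z = 1) (hχ : ContDiff ℝ 1 χ)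
    (hχc : HasCompactSupport χ) (hχ1 : ∀ᶠ z in 𝓝 z₀, χ z = 1) :
    ∫ z, dbar ψ z * (z - z₀)⁻¹ = ∫ z, dbar χ z * (z - z₀)⁻¹ := by
  have hdiff : ∫ z, dbar (fun z => ψ z - χ z) z * (z - z₀)⁻¹ = 0 := by
    refine integral_dbar_mul_eq_zero (hψ.sub hχ) (hψc.sub hχc) fun z hz => analyticAt_inv_sub ?_
    rintro rfl
    refine (notMem_tsupport_iff_eventuallyEq.mpr ?_) hz
    filter_upwards [hψ1, hχ1] with w hψw hχw
    simp [hψw, hχw]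
  have hsplit : ∀ z, dbar (fun z => ψ z - χ z) z * (z - z₀)⁻¹ =
      dbar ψ z * (z - z₀)⁻¹ - dbar χ z * (z - z₀)⁻¹ := fun z => by
    rw [dbar_sub (hψ.differentiable one_ne_zero z) (hχ.differentiable one_ne_zero z), sub_mul]
  simp only [hsplit] at hdiff
  rwa [integral_sub (integrable_dbar_mul_inv_sub hψ hψc hψ1)
    (integrable_dbar_mul_inv_sub hχ hχc hχ1), sub_eq_zero] at hdiff

theorem integral_dbar_mul_inv_sub {ψ : ℂ → ℂ} {z₀ : ℂ} (hψ : ContDiff ℝ 1 ψ)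
    (hc : HasCompactSupport ψ) (hψ1 : ∀ᶠ z in 𝓝 z₀, ψ z = 1) :
    ∫ z, dbar ψ z * (z - z₀)⁻¹ = resConst := by
  have hsub : Filter.Tendsto (fun z => z - z₀) (𝓝 z₀) (𝓝 0) := by
    simpa using (continuous_sub_right z₀).tendsto z₀
  have hdbar : ∀ z, dbar (fun w => cutoff (w - z₀)) z = dbar cutoff (z - z₀) := fun z => by
    rw [dbar_comp (τ := fun w => w - z₀) (contDiff_cutoff.differentiable one_ne_zero _)
      (differentiableAt_id.sub_const z₀)]
    simp
  rw [integral_dbar_mul_inv_sub_congr hψ hc hψ1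
    (contDiff_cutoff.comp (contDiff_id.sub contDiff_const))
    (hasCompactSupport_cutoff.comp_homeomorph (Homeomorph.subRight z₀))
    (hsub.eventually cutoff_eventually_eq_one), resConst]
  simp only [Function.comp_def, id, hdbar]
  exact integral_sub_right_eq_self (fun z => dbar cutoff z * z⁻¹) z₀

theorem analyticAt_update_sub_div {η g : ℂ → ℂ} {z₀ a z : ℂ}
    (hη : z ≠ z₀ → AnalyticAt ℂ η z) (hg : AnalyticAt ℂ g z₀)
    (hpole : ∀ᶠ z in 𝓝[≠] z₀, η z = a / (z - z₀) + g z) :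
    AnalyticAt ℂ (Function.update (fun z => η z - a * (z - z₀)⁻¹) z₀ (g z₀)) z := by
  rcases eq_or_ne z z₀ with rfl | hz
  · refine hg.congr ?_
    filter_upwards [eventually_nhdsWithin_iff.mp hpole] with w hw
    rcases eq_or_ne w z with rfl | hwz
    · rw [Function.update_self]
    · rw [Function.update_of_ne hwz, hw hwz]
      ring
  · refine ((hη hz).sub ((analyticAt_const (v := a)).mul (analyticAt_inv_sub hz))).congr ?_
    filter_upwards [isOpen_ne.mem_nhds hz] with w hw
    rw [Function.update_of_ne hw]
    rfl

theorem integral_dbar_mul_of_simple_pole {ψ η g : ℂ → ℂ} {z₀ a : ℂ} (hψ : ContDiff ℝ 1 ψ)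
    (hc : HasCompactSupport ψ) (hψ1 : ∀ᶠ z in 𝓝 z₀, ψ z = 1)
    (hη : ∀ z ∈ tsupport ψ, z ≠ z₀ → AnalyticAt ℂ η z) (hg : AnalyticAt ℂ g z₀)
    (hpole : ∀ᶠ z in 𝓝[≠] z₀, η z = a / (z - z₀) + g z) :
    ∫ z, dbar ψ z * η z = a * resConst := by
  set θ : ℂ → ℂ := Function.update (fun z => η z - a * (z - z₀)⁻¹) z₀ (g z₀) with hθ
  have hθan : ∀ z ∈ tsupport ψ, AnalyticAt ℂ θ z := fun z hz =>
    analyticAt_update_sub_div (hη z hz) hg hpole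
  have hsplit : ∀ z, dbar ψ z * η z = dbar ψ z * θ z + a * (dbar ψ z * (z - z₀)⁻¹) := by
    intro z
    rcases eq_or_ne z z₀ with rfl | hz
    · simp [dbar_eq_zero_of_eventually_const hψ1]
    · rw [hθ, Function.update_of_ne hz]
      ring
  simp only [hsplit]
  rw [integral_add
    (integrable_dbar_mul hψ hc fun z hz => (hθan z (tsupport_dbar_subset ψ hz)).continuousAt)
    ((integrable_dbar_mul_inv_sub hψ hc hψ1).const_mul a),
    integral_dbar_mul_eq_zero hψ hc hθan, integral_const_mul,
    integral_dbar_mul_inv_sub hψ hc hψ1, zero_add]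

end Plane

section ResidueTheorem

open MeasureTheory Set

variable {X : Type*} [TopologicalSpace X] [ChartedSpace ℂ X]

section Transition

variable [IsManifold 𝓘(ℂ) ω X]

theorem contDiffOn_transition {e e' : OpenPartialHomeomorph X ℂ} (he : e ∈ atlas ℂ X)
    (he' : e' ∈ atlas ℂ X) : ContDiffOn ℂ ω (e.symm ≫ₕ e') (e.symm ≫ₕ e').source := by
  have h := (mem_groupoid_of_pregroupoid.mp
    (HasGroupoid.compatible (G := contDiffGroupoid ω 𝓘(ℂ)) he he')).1
  simpa [contDiffPregroupoid] using h

theorem analyticAt_transition {e e' : OpenPartialHomeomorph X ℂ} (he : e ∈ atlas ℂ X)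
    (he' : e' ∈ atlas ℂ X) {z : ℂ} (hz : z ∈ e.target) (hz' : e.symm z ∈ e'.source) :
    AnalyticAt ℂ (fun w => e' (e.symm w)) z := by
  have hmem : z ∈ (e.symm ≫ₕ e').source := by
    rw [OpenPartialHomeomorph.trans_source]
    exact ⟨hz, hz'⟩
  exact ((contDiffOn_transition he he').contDiffAt
    ((e.symm ≫ₕ e').open_source.mem_nhds hmem)).analyticAt

theorem isManifold_real : IsManifold 𝓘(ℝ, ℂ) ∞ X := by
  refine isManifold_of_contDiffOn _ _ _ fun e e' he he' => ?_
  have h := ((contDiffOn_transition he he').restrict_scalars ℝ).of_le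
    (show (∞ : WithTop ℕ∞) ≤ ω from le_top)
  simpa using h

theorem contDiffAt_comp_chart_symm {f : X → ℝ} (hf : ContMDiff 𝓘(ℝ, ℂ) 𝓘(ℝ) ∞ f) (c : X) {z : ℂ}
    (hz : z ∈ (chartAt ℂ c).target) :
    ContDiffAt ℝ 1 (fun w => ((f ((chartAt ℂ c).symm w) : ℝ) : ℂ)) z := by
  have : IsManifold 𝓘(ℝ, ℂ) ∞ X := isManifold_real
  have hchart : ContMDiffOn 𝓘(ℝ, ℂ) 𝓘(ℝ) ∞ (f ∘ (chartAt ℂ c).symm) (chartAt ℂ c).target :=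
    hf.comp_contMDiffOn contMDiffOn_chart_symm
  have hreal := (contMDiffOn_iff_contDiffOn.mp hchart).contDiffAt
    ((chartAt ℂ c).open_target.mem_nhds hz)
  exact ((Complex.ofRealCLM.contDiff.contDiffAt (n := ∞)).comp z hreal).of_le
    (by exact_mod_cast le_top)

theorem det_restrictScalars_fderiv {τ : ℂ → ℂ} {z : ℂ} :
    ((fderiv ℂ τ z).restrictScalars ℝ).det = Complex.normSq (deriv τ z) := by
  simp only [ContinuousLinearMap.det]
  have : ((((fderiv ℂ τ z).restrictScalars ℝ : ℂ →L[ℝ] ℂ)) : ℂ →ₗ[ℝ] ℂ) =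
    ((fderiv ℂ τ z : ℂ →L[ℂ] ℂ) : ℂ →ₗ[ℂ] ℂ).restrictScalars ℝ := rfl
  rw [this, LinearMap.det_restrictScalars, Algebra.norm_complex_eq,
    LinearMap.det_ring, ← fderiv_apply_one_eq_deriv]
  rfl

theorem setIntegral_target_eq_of_transition {e e' : OpenPartialHomeomorph X ℂ}
    (he : e ∈ atlas ℂ X) (he' : e' ∈ atlas ℂ X) {A B : ℂ → ℂ}
    (hA : ∀ z ∈ e.target, e.symm z ∉ e'.source → A z = 0)
    (hB : ∀ z ∈ e'.target, e'.symm z ∉ e.source → B z = 0)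
    (hAB : ∀ z ∈ e.target, e.symm z ∈ e'.source →
      A z = Complex.normSq (deriv (fun w => e' (e.symm w)) z) * B (e' (e.symm z))) :
    ∫ z in e.target, A z = ∫ z in e'.target, B z := by
  set τ : OpenPartialHomeomorph ℂ ℂ := e.symm ≫ₕ e' with hτ
  have hsource : τ.source = {z | z ∈ e.target ∧ e.symm z ∈ e'.source} := by
    rw [hτ, OpenPartialHomeomorph.trans_source]
    rfl
  have htarget : τ.target = {z | z ∈ e'.target ∧ e'.symm z ∈ e.source} := by
    rw [hτ, OpenPartialHomeomorph.trans_target]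
    rfl
  have hAτ : ∫ z in e.target, A z = ∫ z in τ.source, A z := by
    refine setIntegral_eq_of_subset_of_forall_sdiff_eq_zero e.open_target.measurableSet
      (by rw [hsource]; exact fun z hz => hz.1) fun z hz => hA z hz.1 fun hz' => hz.2 ?_
    rw [hsource]
    exact ⟨hz.1, hz'⟩
  have hBτ : ∫ z in e'.target, B z = ∫ z in τ.target, B z := by
    refine setIntegral_eq_of_subset_of_forall_sdiff_eq_zero e'.open_target.measurableSet
      (by rw [htarget]; exact fun z hz => hz.1) fun z hz => hB z hz.1 fun hz' => hz.2 ?_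
    rw [htarget]
    exact ⟨hz.1, hz'⟩
  have hderiv : ∀ z ∈ τ.source, HasFDerivAt τ ((fderiv ℂ τ z).restrictScalars ℝ) z := by
    intro z hz
    rw [hsource] at hz
    exact (analyticAt_transition he he' hz.1 hz.2).differentiableAt.hasFDerivAt.restrictScalars ℝ
  rw [hAτ, hBτ, integral_target_eq_integral_abs_det_fderiv_smul volume hderiv]
  refine setIntegral_congr_fun τ.open_source.measurableSet fun z hz => ?_
  rw [hsource] at hz
  rw [hAB z hz.1 hz.2, det_restrictScalars_fderiv, abs_of_nonneg (Complex.normSq_nonneg _),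
    Complex.real_smul]
  rfl

end Transition

/-- `F` has at most a simple pole at `z₀`, with residue `a`. -/
def HasSimpleResidueAt (F : ℂ → ℂ) (z₀ a : ℂ) : Prop :=
  ∃ g : ℂ → ℂ, AnalyticAt ℂ g z₀ ∧ ∀ᶠ z in 𝓝[≠] z₀, F z = a / (z - z₀) + g z

/-- A one-form on a Riemann surface which is holomorphic off the finite set `P`. The form is given
by its local expressions `η c z dz` in the charts around the points `c`; on `P` the values of `η`
are irrelevant. -/
structure IsFormHolomorphicOff (P : Finset X) (η : X → ℂ → ℂ) : Prop where
  eq_mul_deriv : ∀ c c' z, z ∈ (chartAt ℂ c).target →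
    (chartAt ℂ c).symm z ∈ (chartAt ℂ c').source → (chartAt ℂ c).symm z ∉ P →
    η c z = η c' (chartAt ℂ c' ((chartAt ℂ c).symm z)) *
      deriv (fun w => chartAt ℂ c' ((chartAt ℂ c).symm w)) z
  analyticAt : ∀ c z, z ∈ (chartAt ℂ c).target → (chartAt ℂ c).symm z ∉ P → AnalyticAt ℂ (η c) z

/-- A finite smooth partition of unity `ρ i`, indexed by points of the surface. The function `ρ i`
lives in the chart around `i`, and each point of the finite set `P` is in the support of at most
one of the functions, namely the one it indexes; hence all of them are constant near `P`. -/
structure ChartPartition (P : Finset X) where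
  index : Finset X
  toFun : X → X → ℝ
  contMDiff : ∀ i, ContMDiff 𝓘(ℝ, ℂ) 𝓘(ℝ) ∞ (toFun i)
  sum_eq_one : ∀ x, ∑ i ∈ index, toFun i x = 1
  tsupport_subset : ∀ i, tsupport (toFun i) ⊆ (chartAt ℂ i).source
  notMem_tsupport : ∀ i, ∀ p ∈ P, p ≠ i → p ∉ tsupport (toFun i)

theorem nonempty_chartPartition [IsManifold 𝓘(ℂ) ω X] [T2Space X] [CompactSpace X]
    (P : Finset X) : Nonempty (ChartPartition P) := by
  classical
  have : IsManifold 𝓘(ℝ, ℂ) ∞ X := isManifold_real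
  let U : X → Set X := fun x => (chartAt ℂ x).source ∩ ((P.erase x : Finset X) : Set X)ᶜ
  obtain ⟨ρ, hρ⟩ := SmoothPartitionOfUnity.exists_isSubordinate 𝓘(ℝ, ℂ) (s := (univ : Set X))
    isClosed_univ U
    (fun x => (chartAt ℂ x).open_source.inter (P.erase x).finite_toSet.isClosed.isOpen_compl)
    fun x _ => mem_iUnion.mpr ⟨x, mem_chart_source ℂ x, by simp⟩
  have hfin : {i | (Function.support (ρ i)).Nonempty}.Finite :=
    ρ.locallyFinite.finite_nonempty_of_compact
  refine ⟨⟨hfin.toFinset, fun i => ρ i, fun i => (ρ i).contMDiff, fun x => ?_,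
    fun i => (hρ i).trans inter_subset_left, fun i p hp hpi hmem => ?_⟩⟩
  · rw [← ρ.sum_eq_one (mem_univ x), finsum_eq_sum_of_support_subset]
    exact fun i hi => hfin.mem_toFinset.mpr ⟨x, hi⟩
  · exact (hρ i hmem).2 (Finset.mem_erase.mpr ⟨hpi, hp⟩)

namespace ChartPartition

variable {P : Finset X} (ρ : ChartPartition P)

theorem eventually_eq_zero {p i : X} (hp : p ∈ P) (hpi : p ≠ i) : ∀ᶠ x in 𝓝 p, ρ.toFun i x = 0 :=
  notMem_tsupport_iff_eventuallyEq.mp (ρ.notMem_tsupport i p hp hpi)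

theorem subset_index : P ⊆ ρ.index := by
  intro p hp
  by_contra hpS
  have hsum : ∑ i ∈ ρ.index, ρ.toFun i p = 0 := Finset.sum_eq_zero fun i hi =>
    (ρ.eventually_eq_zero hp (ne_of_mem_of_not_mem hi hpS).symm).self_of_nhds
  exact zero_ne_one (hsum.symm.trans (ρ.sum_eq_one p))

theorem eventually_eq_one {p : X} (hp : p ∈ P) : ∀ᶠ x in 𝓝 p, ρ.toFun p x = 1 := by
  classical
  have hzero : ∀ᶠ x in 𝓝 p, ∀ i ∈ ρ.index.erase p, ρ.toFun i x = 0 :=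
    (Filter.eventually_all_finset _).mpr fun i hi =>
      ρ.eventually_eq_zero hp (Finset.ne_of_mem_erase hi).symm
  filter_upwards [hzero] with x hx
  rw [← ρ.sum_eq_one x, ← Finset.add_sum_erase _ _ (ρ.subset_index hp), Finset.sum_eq_zero hx,
    add_zero]

theorem exists_eventually_eq {p : X} (hp : p ∈ P) (i : X) :
    ∃ a, ∀ᶠ x in 𝓝 p, ρ.toFun i x = a := by
  rcases eq_or_ne p i with rfl | hpi
  · exact ⟨1, ρ.eventually_eq_one hp⟩
  · exact ⟨0, ρ.eventually_eq_zero hp hpi⟩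

/-- The expression of `ρ i` in the chart around `c`. -/
def loc (i c : X) (z : ℂ) : ℂ := (ρ.toFun i ((chartAt ℂ c).symm z) : ℝ)

theorem sum_loc (c : X) (z : ℂ) : ∑ i ∈ ρ.index, ρ.loc i c z = 1 := by
  simp only [loc]
  rw [← Complex.ofReal_sum, ρ.sum_eq_one, Complex.ofReal_one]

variable {c : X} {z : ℂ}

theorem contDiffAt_loc [IsManifold 𝓘(ℂ) ω X] (i : X) (hz : z ∈ (chartAt ℂ c).target) :
    ContDiffAt ℝ 1 (ρ.loc i c) z :=
  contDiffAt_comp_chart_symm (ρ.contMDiff i) c hz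

theorem loc_eventually_eq {i : X} {a : ℝ} (hz : z ∈ (chartAt ℂ c).target)
    (h : ∀ᶠ x in 𝓝 ((chartAt ℂ c).symm z), ρ.toFun i x = a) :
    ∀ᶠ w in 𝓝 z, ρ.loc i c w = a := by
  filter_upwards [((chartAt ℂ c).continuousAt_symm hz).eventually h] with w hw
  rw [loc, hw]

theorem loc_eventually_eq_zero {i : X} (hz : z ∈ (chartAt ℂ c).target)
    (h : (chartAt ℂ c).symm z ∉ tsupport (ρ.toFun i)) : ∀ᶠ w in 𝓝 z, ρ.loc i c w = 0 := by
  simpa using ρ.loc_eventually_eq (a := 0) hz (notMem_tsupport_iff_eventuallyEq.mp h)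

theorem dbar_loc_eventually_eq_zero (i : X) (hz : z ∈ (chartAt ℂ c).target)
    (hzP : (chartAt ℂ c).symm z ∈ P) : ∀ᶠ w in 𝓝 z, dbar (ρ.loc i c) w = 0 := by
  obtain ⟨a, ha⟩ := ρ.exists_eventually_eq hzP i
  filter_upwards [eventually_eventually_nhds.mpr (ρ.loc_eventually_eq hz ha)] with w hw
  exact dbar_eq_zero_of_eventually_const hw

theorem sum_dbar_loc [IsManifold 𝓘(ℂ) ω X] (hz : z ∈ (chartAt ℂ c).target) :
    ∑ i ∈ ρ.index, dbar (ρ.loc i c) z = 0 := by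
  rw [← dbar_sum fun i _ => (ρ.contDiffAt_loc i hz).differentiableAt one_ne_zero]
  exact dbar_eq_zero_of_eventually_const (c := 1) (Filter.Eventually.of_forall (ρ.sum_loc c))

theorem loc_eq_loc_transition {c' : X} (i : X)
    (hz' : (chartAt ℂ c).symm z ∈ (chartAt ℂ c').source) :
    ρ.loc i c z = ρ.loc i c' (chartAt ℂ c' ((chartAt ℂ c).symm z)) := by
  rw [loc, loc, (chartAt ℂ c').left_inv hz']

theorem dbar_loc_eq_transition [IsManifold 𝓘(ℂ) ω X] {c' : X} (i : X)
    (hz : z ∈ (chartAt ℂ c).target) (hz' : (chartAt ℂ c).symm z ∈ (chartAt ℂ c').source) :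
    dbar (ρ.loc i c) z =
      (starRingEnd ℂ) (deriv (fun w => chartAt ℂ c' ((chartAt ℂ c).symm w)) z) *
        dbar (ρ.loc i c') (chartAt ℂ c' ((chartAt ℂ c).symm z)) := by
  have hloc : ρ.loc i c =ᶠ[𝓝 z] fun w => ρ.loc i c' (chartAt ℂ c' ((chartAt ℂ c).symm w)) := by
    filter_upwards [((chartAt ℂ c).continuousAt_symm hz).eventually_mem
      ((chartAt ℂ c').open_source.mem_nhds hz')] with w hw
    exact ρ.loc_eq_loc_transition i hw
  rw [dbar_congr hloc, dbar_comp (τ := fun w => chartAt ℂ c' ((chartAt ℂ c).symm w))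
    ((ρ.contDiffAt_loc i ((chartAt ℂ c').map_source hz')).differentiableAt one_ne_zero)
    (analyticAt_transition (chart_mem_atlas ℂ c) (chart_mem_atlas ℂ c') hz hz').differentiableAt]

/-- The image of the support of `ρ i` in the chart around `i`. -/
def locSupport (i : X) : Set ℂ := chartAt ℂ i '' tsupport (ρ.toFun i)

theorem isCompact_locSupport [CompactSpace X] (i : X) : IsCompact (ρ.locSupport i) :=
  (isClosed_tsupport _).isCompact.image_of_continuousOn
    ((chartAt ℂ i).continuousOn.mono (ρ.tsupport_subset i))

theorem mem_locSupport {i : X} :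
    z ∈ ρ.locSupport i ↔
      z ∈ (chartAt ℂ i).target ∧ (chartAt ℂ i).symm z ∈ tsupport (ρ.toFun i) := by
  refine ⟨?_, fun h => ⟨_, h.2, (chartAt ℂ i).right_inv h.1⟩⟩
  rintro ⟨x, hx, rfl⟩
  have hxi := ρ.tsupport_subset i hx
  exact ⟨(chartAt ℂ i).map_source hxi, by rwa [(chartAt ℂ i).left_inv hxi]⟩

/-- The expression, in the chart around `c`, of the `(1, 1)`-form `ρ k ∂̄(ρ i) ∧ η`. -/
def wedge (η : X → ℂ → ℂ) (i k c : X) (z : ℂ) : ℂ :=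
  ρ.loc k c z * (dbar (ρ.loc i c) z * η c z)

theorem wedge_eq_zero {η : X → ℂ → ℂ} {i k : X} (hz : z ∈ (chartAt ℂ c).target)
    (h : (chartAt ℂ c).symm z ∉ tsupport (ρ.toFun i) ∨
      (chartAt ℂ c).symm z ∉ tsupport (ρ.toFun k)) : ρ.wedge η i k c z = 0 := by
  rcases h with h | h
  · rw [wedge, dbar_eq_zero_of_eventually_const (ρ.loc_eventually_eq_zero hz h), zero_mul, mul_zero]
  · rw [wedge, (ρ.loc_eventually_eq_zero hz h).self_of_nhds, zero_mul]

section Integral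

variable [IsManifold 𝓘(ℂ) ω X] {η : X → ℂ → ℂ}

theorem continuousOn_wedge (hη : IsFormHolomorphicOff P η) (i k c : X) :
    ContinuousOn (ρ.wedge η i k c) (chartAt ℂ c).target := by
  refine fun z hz => ((ρ.contDiffAt_loc k hz).continuousAt.mul ?_).continuousWithinAt
  by_cases hzP : (chartAt ℂ c).symm z ∈ P
  · refine (continuousAt_const (y := (0 : ℂ))).congr ?_
    filter_upwards [ρ.dbar_loc_eventually_eq_zero i hz hzP] with w hw
    rw [hw, zero_mul]
  · exact (continuousAt_dbar (ρ.contDiffAt_loc i hz)).mul (hη.analyticAt c z hz hzP).continuousAt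

theorem integrableOn_wedge [CompactSpace X] (hη : IsFormHolomorphicOff P η) {i k c : X}
    (hc : c = i ∨ c = k) : IntegrableOn (ρ.wedge η i k c) (chartAt ℂ c).target := by
  have hK : IntegrableOn (ρ.wedge η i k c) (ρ.locSupport c) :=
    ContinuousOn.integrableOn_compact (ρ.isCompact_locSupport c)
      ((ρ.continuousOn_wedge hη i k c).mono fun z hz => (ρ.mem_locSupport.mp hz).1)
  refine hK.of_forall_sdiff_eq_zero (chartAt ℂ c).open_target.measurableSet fun z hz => ?_
  have hzc : (chartAt ℂ c).symm z ∉ tsupport (ρ.toFun c) := fun h =>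
    hz.2 (ρ.mem_locSupport.mpr ⟨hz.1, h⟩)
  refine ρ.wedge_eq_zero hz.1 ?_
  rcases hc with rfl | rfl
  · exact Or.inl hzc
  · exact Or.inr hzc

theorem setIntegral_wedge_comm (hη : IsFormHolomorphicOff P η) (i k : X) :
    ∫ z in (chartAt ℂ i).target, ρ.wedge η i k i z =
      ∫ z in (chartAt ℂ k).target, ρ.wedge η i k k z := by
  refine setIntegral_target_eq_of_transition (chart_mem_atlas ℂ i) (chart_mem_atlas ℂ k)
    (fun z hz hzk => ρ.wedge_eq_zero hz (Or.inr fun h => hzk (ρ.tsupport_subset k h)))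
    (fun z hz hzi => ρ.wedge_eq_zero hz (Or.inl fun h => hzi (ρ.tsupport_subset i h)))
    fun z hz hz' => ?_
  have hzt := (chartAt ℂ k).map_source hz'
  have hdbar := ρ.dbar_loc_eq_transition i hz hz'
  rw [wedge, wedge, ρ.loc_eq_loc_transition k hz', hdbar]
  by_cases hzP : (chartAt ℂ i).symm z ∈ P
  · have hzero : dbar (ρ.loc i k) (chartAt ℂ k ((chartAt ℂ i).symm z)) = 0 :=
      (ρ.dbar_loc_eventually_eq_zero i hzt
        (by rwa [(chartAt ℂ k).left_inv hz'])).self_of_nhds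
    simp [hzero]
  · rw [hη.eq_mul_deriv i k z hz hz' hzP, ← Complex.mul_conj]
    ring

/-- Insert `1 = ∑ ρ k`, move the `(i, k)` term from the chart at `i` to the chart at `k`, and sum
over `i` first: what remains is `∂̄ (∑ ρ i) = 0`. -/
theorem sum_setIntegral_dbar_loc_mul [CompactSpace X] (hη : IsFormHolomorphicOff P η) :
    ∑ i ∈ ρ.index, ∫ z in (chartAt ℂ i).target, dbar (ρ.loc i i) z * η i z = 0 := by
  have hsplit : ∀ i, ∫ z in (chartAt ℂ i).target, dbar (ρ.loc i i) z * η i z =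
      ∑ k ∈ ρ.index, ∫ z in (chartAt ℂ k).target, ρ.wedge η i k k z := by
    intro i
    rw [Finset.sum_congr rfl fun k _ => (ρ.setIntegral_wedge_comm hη i k).symm,
      ← integral_finsetSum _ fun k _ => ρ.integrableOn_wedge hη (Or.inl rfl)]
    refine setIntegral_congr_fun (chartAt ℂ i).open_target.measurableSet fun z _ => ?_
    simp only [wedge]
    rw [← Finset.sum_mul, ρ.sum_loc, one_mul]
  rw [Finset.sum_congr rfl fun i _ => hsplit i, Finset.sum_comm]
  refine Finset.sum_eq_zero fun k _ => ?_
  rw [← integral_finsetSum _ fun i _ => ρ.integrableOn_wedge hη (Or.inr rfl)]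
  refine setIntegral_eq_zero_of_forall_eq_zero fun z hz => ?_
  simp only [wedge]
  rw [← Finset.mul_sum, ← Finset.sum_mul, ρ.sum_dbar_loc hz, zero_mul, mul_zero]

end Integral

/-- The extension by zero to the plane of `ρ i` in its own chart. -/
def extension (i : X) : ℂ → ℂ := (chartAt ℂ i).target.indicator (ρ.loc i i)

theorem extension_eventuallyEq {i : X} (hz : z ∈ (chartAt ℂ i).target) :
    ρ.extension i =ᶠ[𝓝 z] ρ.loc i i := by
  filter_upwards [(chartAt ℂ i).open_target.mem_nhds hz] with w hw
  exact indicator_of_mem hw _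

theorem support_extension_subset (i : X) : Function.support (ρ.extension i) ⊆ ρ.locSupport i := by
  intro z hz
  have hzt : z ∈ (chartAt ℂ i).target := mem_of_indicator_ne_zero hz
  refine ρ.mem_locSupport.mpr ⟨hzt, ?_⟩
  by_contra h
  refine hz ?_
  rw [(ρ.extension_eventuallyEq hzt).self_of_nhds]
  exact (ρ.loc_eventually_eq_zero hzt h).self_of_nhds

variable [CompactSpace X]

theorem hasCompactSupport_extension (i : X) : HasCompactSupport (ρ.extension i) :=
  HasCompactSupport.of_support_subset_isCompact (ρ.isCompact_locSupport i)
    (ρ.support_extension_subset i)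

theorem tsupport_extension_subset (i : X) : tsupport (ρ.extension i) ⊆ ρ.locSupport i :=
  closure_minimal (ρ.support_extension_subset i) (ρ.isCompact_locSupport i).isClosed

theorem extension_eventually_eq_zero {i : X} (hz : z ∉ (chartAt ℂ i).target) :
    ∀ᶠ w in 𝓝 z, ρ.extension i w = 0 :=
  notMem_tsupport_iff_eventuallyEq.mp fun h =>
    hz (ρ.mem_locSupport.mp (ρ.tsupport_extension_subset i h)).1

theorem contDiff_extension [IsManifold 𝓘(ℂ) ω X] (i : X) : ContDiff ℝ 1 (ρ.extension i) := by
  rw [contDiff_iff_contDiffAt]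
  intro z
  by_cases hz : z ∈ (chartAt ℂ i).target
  · exact (ρ.contDiffAt_loc i hz).congr_of_eventuallyEq (ρ.extension_eventuallyEq hz)
  · exact contDiffAt_const.congr_of_eventuallyEq (ρ.extension_eventually_eq_zero hz)

theorem setIntegral_dbar_loc_mul (i : X) (h : ℂ → ℂ) :
    ∫ z in (chartAt ℂ i).target, dbar (ρ.loc i i) z * h z =
      ∫ z, dbar (ρ.extension i) z * h z := by
  have hext : ∫ z in (chartAt ℂ i).target, dbar (ρ.extension i) z * h z =
      ∫ z, dbar (ρ.extension i) z * h z := by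
    refine setIntegral_eq_integral_of_forall_compl_eq_zero fun z hz => ?_
    rw [dbar_eq_zero_of_eventually_const (ρ.extension_eventually_eq_zero hz), zero_mul]
  rw [← hext]
  refine setIntegral_congr_fun (chartAt ℂ i).open_target.measurableSet fun z hz => ?_
  rw [dbar_congr (ρ.extension_eventuallyEq hz)]

variable {η : X → ℂ → ℂ}

theorem analyticAt_of_mem_tsupport_extension (hη : IsFormHolomorphicOff P η) {i : X}
    (hz : z ∈ tsupport (ρ.extension i)) (h : (chartAt ℂ i).symm z = i → i ∉ P) :
    AnalyticAt ℂ (η i) z := by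
  obtain ⟨hzt, hzs⟩ := ρ.mem_locSupport.mp (ρ.tsupport_extension_subset i hz)
  refine hη.analyticAt i z hzt fun hzP => ?_
  have hzi : (chartAt ℂ i).symm z = i := by
    by_contra hne
    exact ρ.notMem_tsupport i _ hzP hne hzs
  exact h hzi (hzi ▸ hzP)

variable [IsManifold 𝓘(ℂ) ω X]

theorem integral_dbar_extension_mul_of_notMem (hη : IsFormHolomorphicOff P η) {i : X}
    (hi : i ∉ P) : ∫ z, dbar (ρ.extension i) z * η i z = 0 :=
  integral_dbar_mul_eq_zero (ρ.contDiff_extension i) (ρ.hasCompactSupport_extension i)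
    fun _ hz => ρ.analyticAt_of_mem_tsupport_extension hη hz fun _ => hi

theorem integral_dbar_extension_mul_of_mem (hη : IsFormHolomorphicOff P η) {p : X} (hp : p ∈ P)
    {a : ℂ} (ha : HasSimpleResidueAt (η p) (chartAt ℂ p p) a) :
    ∫ z, dbar (ρ.extension p) z * η p z = a * resConst := by
  obtain ⟨g, hg, hpole⟩ := ha
  have hpt := mem_chart_target ℂ p
  have hone : ∀ᶠ w in 𝓝 (chartAt ℂ p p), ρ.extension p w = 1 := by
    have hloc := ρ.loc_eventually_eq (i := p) (a := 1) hpt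
      (by simpa using ρ.eventually_eq_one hp)
    filter_upwards [ρ.extension_eventuallyEq hpt, hloc] with w hw hw'
    rw [hw, hw', Complex.ofReal_one]
  refine integral_dbar_mul_of_simple_pole (ρ.contDiff_extension p) (ρ.hasCompactSupport_extension p)
    hone (fun z hz hzp => ρ.analyticAt_of_mem_tsupport_extension hη hz fun h => ?_) hg hpole
  have hzt := (ρ.mem_locSupport.mp (ρ.tsupport_extension_subset p hz)).1
  exact absurd (by rw [← (chartAt ℂ p).right_inv hzt, h]) hzp

end ChartPartition

variable [IsManifold 𝓘(ℂ) ω X] [T2Space X] [CompactSpace X]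

theorem sum_residue_eq_zero {P : Finset X} {η : X → ℂ → ℂ} (hη : IsFormHolomorphicOff P η)
    {r : X → ℂ} (hr : ∀ p ∈ P, HasSimpleResidueAt (η p) (chartAt ℂ p p) (r p)) :
    ∑ p ∈ P, r p = 0 := by
  obtain ⟨ρ⟩ := nonempty_chartPartition P
  have htotal := ρ.sum_setIntegral_dbar_loc_mul hη
  simp only [ρ.setIntegral_dbar_loc_mul] at htotal
  rw [← Finset.sum_subset ρ.subset_index fun i _ hi =>
    ρ.integral_dbar_extension_mul_of_notMem hη hi,
    Finset.sum_congr rfl fun p hp => ρ.integral_dbar_extension_mul_of_mem hη hp (hr p hp),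
    ← Finset.sum_mul] at htotal
  exact (mul_eq_zero.mp htotal).resolve_right resConst_ne_zero

end ResidueTheorem

section MeromorphicFunctions

open Filter Set

theorem divDegree_add {X : Type*} (D E : X →₀ ℤ) : divDegree (D + E) = divDegree D + divDegree E :=
  Finsupp.sum_add_index' (fun _ => rfl) fun _ _ _ => rfl

theorem divDegree_single {X : Type*} (q : X) (n : ℤ) : divDegree (Finsupp.single q n) = n :=
  Finsupp.sum_single_index rfl

theorem finite_compl_of_eventually_nhdsNE {X : Type*} [TopologicalSpace X] [T1Space X]
    [CompactSpace X] {s : Set X} (h : ∀ x, ∀ᶠ y in 𝓝[≠] x, y ∈ s) : sᶜ.Finite := by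
  have hs : s ∈ codiscrete X := mem_codiscrete.mpr fun x => by
    rw [disjoint_principal_right, compl_compl]
    exact h x
  rwa [codiscrete_eq_cofinite] at hs

variable {X : Type*} [TopologicalSpace X] [ChartedSpace ℂ X]

theorem map_chartAt_nhdsNE (x : X) : map (chartAt ℂ x) (𝓝[≠] x) = 𝓝[≠] (chartAt ℂ x x) := by
  have hx := mem_chart_source ℂ x
  have himage : chartAt ℂ x '' ((chartAt ℂ x).source ∩ {x}ᶜ) =
      (chartAt ℂ x).target ∩ {chartAt ℂ x x}ᶜ := by
    rw [← sdiff_eq, ← sdiff_eq, (chartAt ℂ x).injOn.image_sdiff_subset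
      (singleton_subset_iff.mpr hx), (chartAt ℂ x).image_source_eq_target, image_singleton]
  rw [(chartAt ℂ x).map_nhdsWithin_eq hx, himage,
    (chartAt ℂ x).nhdsWithin_target_inter (mem_chart_target ℂ x)]

theorem eventually_nhdsNE_chartAt_iff (x : X) (q : X → Prop) :
    (∀ᶠ z in 𝓝[≠] (chartAt ℂ x x), q ((chartAt ℂ x).symm z)) ↔ ∀ᶠ y in 𝓝[≠] x, q y := by
  rw [← map_chartAt_nhdsNE, eventually_map]
  refine eventually_congr (eventually_nhdsWithin_of_eventually_nhds ?_)
  filter_upwards [(chartAt ℂ x).eventually_left_inverse (mem_chart_source ℂ x)] with y hy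
  rw [hy]

theorem nhdsNE_neBot (x : X) : (𝓝[≠] x).NeBot := by
  rw [← map_neBot_iff (chartAt ℂ x), map_chartAt_nhdsNE]
  infer_instance

theorem ordAt_eq_top_iff {f : X → ℂ} {x : X} : ordAt f x = ⊤ ↔ ∀ᶠ y in 𝓝[≠] x, f y = 0 := by
  rw [ordAt, meromorphicOrderAt_eq_top_iff]
  exact eventually_nhdsNE_chartAt_iff x fun y => f y = 0

theorem eventually_eq_zero_or_ne_zero {f : X → ℂ} {x : X} (hf : MeroAt f x) :
    (∀ᶠ y in 𝓝[≠] x, f y = 0) ∨ ∀ᶠ y in 𝓝[≠] x, f y ≠ 0 := by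
  rw [← eventually_nhdsNE_chartAt_iff x, ← eventually_nhdsNE_chartAt_iff x (fun y => f y ≠ 0)]
  exact hf.eventually_eq_zero_or_eventually_ne_zero

theorem eventually_ne_zero_iff {f : X → ℂ} {x : X} (hf : MeroAt f x) :
    (∀ᶠ y in 𝓝[≠] x, f y ≠ 0) ↔ ordAt f x ≠ ⊤ := by
  rw [Ne, ordAt_eq_top_iff]
  refine ⟨fun hne hzero => ?_, (eventually_eq_zero_or_ne_zero hf).resolve_left⟩
  have := nhdsNE_neBot x
  obtain ⟨y, hy, hy'⟩ := (hne.and hzero).exists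
  exact hy hy'

theorem ordAt_eq_top_of_ordAt_eq_top [ConnectedSpace X] [T1Space X] {f : X → ℂ}
    (hf : ∀ x, MeroAt f x) {x₀ : X} (h : ordAt f x₀ = ⊤) (x : X) : ordAt f x = ⊤ := by
  have hopen : IsOpen {x | ordAt f x = ⊤} := by
    simp only [ordAt_eq_top_iff]
    exact isOpen_setOfPred_eventually_nhdsWithin
  have hclosed : IsClosed {x | ordAt f x = ⊤} := by
    have hcompl : {x | ordAt f x = ⊤}ᶜ = {x | ∀ᶠ y in 𝓝[≠] x, f y ≠ 0} :=
      Set.ext fun x => (eventually_ne_zero_iff (hf x)).symm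
    rw [← isOpen_compl_iff, hcompl]
    exact isOpen_setOfPred_eventually_nhdsWithin
  exact (IsClopen.eq_univ ⟨hclosed, hopen⟩ ⟨x₀, h⟩).ge (mem_univ x)

/-- `f` is holomorphic at `y`, as a function read in the chart around `y`. -/
def HolAt (f : X → ℂ) (y : X) : Prop := AnalyticAt ℂ (f ∘ (chartAt ℂ y).symm) (chartAt ℂ y y)

theorem HolAt.ordAt_eq_zero {f : X → ℂ} {y : X} (h : HolAt f y) (hne : f y ≠ 0) :
    ordAt f y = 0 := by
  have hne' : (f ∘ (chartAt ℂ y).symm) (chartAt ℂ y y) ≠ 0 := by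
    simpa [(chartAt ℂ y).left_inv (mem_chart_source ℂ y)] using hne
  rw [ordAt, AnalyticAt.meromorphicOrderAt_eq h, h.analyticOrderAt_eq_zero.mpr hne']
  rfl

theorem hasSimpleResidueAt_logDeriv {F : ℂ → ℂ} {z₀ : ℂ} {n : ℤ} (hF : MeromorphicAt F z₀)
    (hn : meromorphicOrderAt F z₀ = n) : HasSimpleResidueAt (logDeriv F) z₀ n := by
  obtain ⟨G, hG, hG0, hFG⟩ := (meromorphicOrderAt_eq_int_iff hF).mp hn
  refine ⟨logDeriv G, hG.deriv.div hG hG0, ?_⟩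
  filter_upwards [logDeriv_congr_nhdsNE hFG, self_mem_nhdsWithin,
    hG.eventually_analyticAt.filter_mono nhdsWithin_le_nhds,
    (hG.continuousAt.eventually_ne hG0).filter_mono nhdsWithin_le_nhds] with z hz hne hGz hGz0
  have hsub : z - z₀ ≠ 0 := sub_ne_zero.mpr hne
  simp only [hz, smul_eq_mul]
  rw [logDeriv_mul (f := fun w => (w - z₀) ^ n) z (zpow_ne_zero n hsub) hGz0
    ((differentiableAt_id.sub_const z₀).zpow (Or.inl hsub)) hGz.differentiableAt,
    logDeriv_fun_zpow (by fun_prop)]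
  simp [logDeriv_apply, div_eq_mul_inv]

theorem comp_chartAt_symm_eventuallyEq {f : X → ℂ} {c c' : X} {z : ℂ}
    (hz : z ∈ (chartAt ℂ c).target) (hz' : (chartAt ℂ c).symm z ∈ (chartAt ℂ c').source) :
    f ∘ (chartAt ℂ c).symm =ᶠ[𝓝 z]
      (f ∘ (chartAt ℂ c').symm) ∘ fun w => chartAt ℂ c' ((chartAt ℂ c).symm w) := by
  filter_upwards [((chartAt ℂ c).continuousAt_symm hz).eventually_mem
    ((chartAt ℂ c').open_source.mem_nhds hz')] with w hw
  simp only [Function.comp_apply, (chartAt ℂ c').left_inv hw]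

variable [IsManifold 𝓘(ℂ) ω X]

theorem analyticAt_comp_chartAt_symm {f : X → ℂ} {c c' : X} {z : ℂ}
    (hz : z ∈ (chartAt ℂ c).target) (hz' : (chartAt ℂ c).symm z ∈ (chartAt ℂ c').source)
    (h : AnalyticAt ℂ (f ∘ (chartAt ℂ c').symm) (chartAt ℂ c' ((chartAt ℂ c).symm z))) :
    AnalyticAt ℂ (f ∘ (chartAt ℂ c).symm) z :=
  (h.fun_comp (f := fun w => chartAt ℂ c' ((chartAt ℂ c).symm w)) (analyticAt_transition
    (chart_mem_atlas ℂ c) (chart_mem_atlas ℂ c') hz hz')).congr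
    (comp_chartAt_symm_eventuallyEq hz hz').symm

theorem HolAt.analyticAt {f : X → ℂ} {c : X} {z : ℂ} (hz : z ∈ (chartAt ℂ c).target)
    (h : HolAt f ((chartAt ℂ c).symm z)) : AnalyticAt ℂ (f ∘ (chartAt ℂ c).symm) z :=
  analyticAt_comp_chartAt_symm hz (mem_chart_source ℂ _) h

theorem eventually_holAt {f : X → ℂ} {x : X} (hf : MeroAt f x) : ∀ᶠ y in 𝓝[≠] x, HolAt f y := by
  have hanalytic := hf.eventually_analyticAt
  rw [← map_chartAt_nhdsNE, eventually_map] at hanalytic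
  filter_upwards [hanalytic, mem_nhdsWithin_of_mem_nhds (chart_source_mem_nhds ℂ x)] with y hy hys
  have hsymm := (chartAt ℂ y).left_inv (mem_chart_source ℂ y)
  refine analyticAt_comp_chartAt_symm (c' := x) (mem_chart_target ℂ y) ?_ ?_ <;> rwa [hsymm]

theorem isFormHolomorphicOff_logDeriv {f : X → ℂ} {P : Finset X}
    (hP : ∀ y, y ∉ P → HolAt f y ∧ f y ≠ 0) :
    IsFormHolomorphicOff P fun c => logDeriv (f ∘ (chartAt ℂ c).symm) where
  eq_mul_deriv c c' z hz hz' hzP := by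
    have hf : DifferentiableAt ℂ (f ∘ (chartAt ℂ c').symm)
        (chartAt ℂ c' ((chartAt ℂ c).symm z)) := by
      refine (HolAt.analyticAt ((chartAt ℂ c').map_source hz') ?_).differentiableAt
      rw [(chartAt ℂ c').left_inv hz']
      exact (hP _ hzP).1
    have htransition := (analyticAt_transition (chart_mem_atlas ℂ c) (chart_mem_atlas ℂ c') hz
      hz').differentiableAt
    rw [← logDeriv_comp (g := fun w => chartAt ℂ c' ((chartAt ℂ c).symm w)) hf htransition]
    exact (logDeriv_congr_nhds (comp_chartAt_symm_eventuallyEq hz hz')).self_of_nhds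
  analyticAt c z hz hzP :=
    have hf := (hP _ hzP).1.analyticAt hz
    hf.deriv.div hf (hP _ hzP).2

theorem finite_compl_holAt_and_ne_zero [T1Space X] [CompactSpace X] {f : X → ℂ}
    (hf : ∀ x, MeroAt f x) (htop : ∀ x, ordAt f x ≠ ⊤) : {y | HolAt f y ∧ f y ≠ 0}ᶜ.Finite :=
  finite_compl_of_eventually_nhdsNE fun x =>
    (eventually_holAt (hf x)).and ((eventually_ne_zero_iff (hf x)).mpr (htop x))

theorem divDegree_eq_zero [T2Space X] [CompactSpace X] {f : X → ℂ} (hf : ∀ x, MeroAt f x)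
    {E : X →₀ ℤ} (hE : ∀ x, ordAt f x = (E x : WithTop ℤ)) : divDegree E = 0 := by
  have hfin := finite_compl_holAt_and_ne_zero hf fun x => by
    rw [hE x]
    exact WithTop.coe_ne_top
  have hP : ∀ y, y ∉ hfin.toFinset → HolAt f y ∧ f y ≠ 0 := fun y hy =>
    not_not.mp (mt hfin.mem_toFinset.mpr hy)
  have hsum := sum_residue_eq_zero (isFormHolomorphicOff_logDeriv hP) (r := fun p => (E p : ℂ))
    fun p _ => hasSimpleResidueAt_logDeriv (hf p) (hE p)
  have hsupport : E.support ⊆ hfin.toFinset := by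
    intro y hy
    by_contra hyP
    have hzero := (hP y hyP).1.ordAt_eq_zero (hP y hyP).2
    rw [hE y] at hzero
    exact Finsupp.mem_support_iff.mp hy (by exact_mod_cast hzero)
  rw [divDegree, Finsupp.sum,
    Finset.sum_subset hsupport fun y _ hy => Finsupp.notMem_support_iff.mp hy]
  exact_mod_cast hsum

theorem exists_forall_ordAt_eq_coe [ConnectedSpace X] [T1Space X] [CompactSpace X] {f : X → ℂ}
    (hf : ∀ x, MeroAt f x) (h0 : f ∉ nullFun X) :
    ∃ E : X →₀ ℤ, ∀ x, ordAt f x = (E x : WithTop ℤ) := by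
  have htop : ∀ x, ordAt f x ≠ ⊤ := fun x hx =>
    h0 fun y => ordAt_eq_top_iff.mp (ordAt_eq_top_of_ordAt_eq_top hf hx y)
  have hfin : {x | (ordAt f x).untop₀ ≠ 0}.Finite :=
    (finite_compl_holAt_and_ne_zero hf htop).subset fun x hx h =>
      hx (by rw [h.1.ordAt_eq_zero h.2]; rfl)
  exact ⟨Finsupp.ofSupportFinite _ hfin, fun x => (WithTop.coe_untop₀_of_ne_top (htop x)).symm⟩

theorem sectionSpace_le_nullFun [ConnectedSpace X] [T2Space X] [CompactSpace X] {D : X →₀ ℤ}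
    (hD : divDegree D < 0) : sectionSpace D ≤ nullFun X := by
  intro f hf
  by_contra h0
  obtain ⟨E, hE⟩ := exists_forall_ordAt_eq_coe (fun x => (hf x).1) h0
  have hdeg := divDegree_eq_zero (fun x => (hf x).1) hE
  have hnonneg : 0 ≤ divDegree (E + D) := Finset.sum_nonneg fun x _ => by
    have hord := (hf x).2
    rw [hE x] at hord
    have hle : -(D x) ≤ E x := by exact_mod_cast hord
    rw [Finsupp.add_apply]
    lia
  rw [divDegree_add] at hnonneg
  lia

end MeromorphicFunctions

section Sections

open Filter Set Module

section OneStep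

variable {K V : Type*} [Field K] [AddCommGroup V] [Module K V] {M M' : Submodule K V}

theorem sup_span_singleton_eq_of_forall_sub_smul_mem (hle : M ≤ M') {g : V} (hg : g ∈ M')
    (h : ∀ f ∈ M', ∃ c : K, f - c • g ∈ M) : M ⊔ Submodule.span K {g} = M' := by
  refine le_antisymm (sup_le hle (by simpa using hg)) fun f hf => ?_
  obtain ⟨c, hc⟩ := h f hf
  rw [← sub_add_cancel f (c • g)]
  exact Submodule.add_mem_sup hc (Submodule.smul_mem _ _ (Submodule.mem_span_singleton_self g))

theorem finiteDimensional_of_forall_sub_smul_mem [FiniteDimensional K M] (hle : M ≤ M')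
    (h : ∀ g ∈ M', g ∉ M → ∀ f ∈ M', ∃ c : K, f - c • g ∈ M) : FiniteDimensional K M' := by
  by_cases heq : M' ≤ M
  · exact Submodule.finiteDimensional_of_le heq
  · obtain ⟨g, hg, hg'⟩ := SetLike.not_le_iff_exists.mp heq
    rw [← sup_span_singleton_eq_of_forall_sub_smul_mem hle hg (h g hg hg')]
    infer_instance

open Classical in
theorem finrank_eq_add_ite_of_forall_sub_smul_mem [FiniteDimensional K M] (hle : M ≤ M')
    (h : ∀ g ∈ M', g ∉ M → ∀ f ∈ M', ∃ c : K, f - c • g ∈ M) :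
    finrank K M' = finrank K M + if M' ≤ M then 0 else 1 := by
  split_ifs with heq
  · rw [le_antisymm heq hle, add_zero]
  · obtain ⟨g, hg, hg'⟩ := SetLike.not_le_iff_exists.mp heq
    have hg0 : g ≠ 0 := fun h => hg' (h ▸ M.zero_mem)
    have hinf : M ⊓ Submodule.span K {g} = ⊥ :=
      disjoint_iff.mp ((Submodule.disjoint_span_singleton' hg0).mpr hg')
    have hdim := Submodule.finrank_sup_add_finrank_inf_eq M (Submodule.span K {g})
    rwa [sup_span_singleton_eq_of_forall_sub_smul_mem hle hg (h g hg hg'), hinf, finrank_bot,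
      add_zero, finrank_span_singleton hg0] at hdim

end OneStep

theorem withTop_neg_le_iff {o : WithTop ℤ} {d : ℤ} : ((-d : ℤ) : WithTop ℤ) ≤ o ↔ 0 ≤ o + d := by
  cases o with
  | top => simp
  | coe o => norm_cast; lia

theorem withTop_add_eq_coe_iff {o : WithTop ℤ} {d e : ℤ} :
    o + d = (e : WithTop ℤ) ↔ o = ((e - d : ℤ) : WithTop ℤ) := by
  cases o with
  | top => simp only [WithTop.top_add, WithTop.coe_ne_top.symm]
  | coe o => norm_cast; lia

theorem withTop_eq_sub_one_iff {o : WithTop ℤ} {n : ℤ} :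
    o = ((n - 1 : ℤ) : WithTop ℤ) ↔ ((n - 1 : ℤ) : WithTop ℤ) ≤ o ∧ ¬(n : WithTop ℤ) ≤ o := by
  cases o with
  | top => simp only [le_top, not_true, and_false, WithTop.coe_ne_top.symm]
  | coe o => norm_cast; lia

theorem withTop_add_one_le_of_pos {o : WithTop ℤ} {n : ℤ} (h : 0 < o) :
    ((n + 1 : ℤ) : WithTop ℤ) ≤ n + o := by
  cases o with
  | top => simp
  | coe o =>
    norm_cast at h ⊢
    lia

theorem exists_add_one_le_meromorphicOrderAt_sub_smul {F G : ℂ → ℂ} {z₀ : ℂ} {n : ℤ}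
    (hF : MeromorphicAt F z₀) (hG : MeromorphicAt G z₀)
    (hFn : (n : WithTop ℤ) ≤ meromorphicOrderAt F z₀) (hGn : meromorphicOrderAt G z₀ = n) :
    ∃ c : ℂ, ((n + 1 : ℤ) : WithTop ℤ) ≤ meromorphicOrderAt (F - c • G) z₀ := by
  have hQ : MeromorphicAt (F / G) z₀ := hF.div hG
  have hGne : ∀ᶠ z in 𝓝[≠] z₀, G z ≠ 0 :=
    (meromorphicOrderAt_ne_top_iff_eventually_ne_zero hG).mp (by rw [hGn]; exact WithTop.coe_ne_top)
  have hFQ : F =ᶠ[𝓝[≠] z₀] G * (F / G) := by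
    filter_upwards [hGne] with z hz using (mul_div_cancel₀ (F z) hz).symm
  have hQn : 0 ≤ meromorphicOrderAt (F / G) z₀ := by
    rw [meromorphicOrderAt_congr hFQ, meromorphicOrderAt_mul hG hQ, hGn] at hFn
    generalize meromorphicOrderAt (F / G) z₀ = o at hFn
    cases o with
    | top => simp
    | coe o => norm_cast at hFn ⊢; lia
  -- The multiple is the value at `z₀` of the quotient, which extends continuously.
  obtain ⟨c, hc⟩ := tendsto_nhds_of_meromorphicOrderAt_nonneg hQ hQn
  have hR : MeromorphicAt (fun z => (F / G) z - c) z₀ := hQ.sub (MeromorphicAt.const c z₀)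
  have hRpos : 0 < meromorphicOrderAt (fun z => (F / G) z - c) z₀ := by
    rw [← tendsto_zero_iff_meromorphicOrderAt_pos hR]
    simpa using hc.sub_const c
  have hfactor : F - c • G =ᶠ[𝓝[≠] z₀] G * fun z => (F / G) z - c := by
    filter_upwards [hGne] with z hz
    simp only [Pi.sub_apply, Pi.smul_apply, smul_eq_mul, Pi.mul_apply, Pi.div_apply]
    field_simp
  refine ⟨c, ?_⟩
  rw [meromorphicOrderAt_congr hfactor, meromorphicOrderAt_mul hG hR, hGn]
  exact withTop_add_one_le_of_pos hRpos

theorem le_add_single_one {X : Type*} (D : X →₀ ℤ) (q : X) : D ≤ D + Finsupp.single q 1 :=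
  le_add_of_nonneg_right (Finsupp.single_nonneg.mpr zero_le_one)

variable {X : Type*} [TopologicalSpace X] [ChartedSpace ℂ X]

theorem sectionSpace_mono {D D' : X →₀ ℤ} (h : D ≤ D') : sectionSpace D ≤ sectionSpace D' :=
  fun _ hf x => ⟨(hf x).1, le_trans (WithTop.coe_le_coe.mpr (neg_le_neg (h x))) (hf x).2⟩

theorem nullFun_le_sectionSpace (D : X →₀ ℤ) : nullFun X ≤ sectionSpace D := by
  intro f hf x
  have htop : ordAt f x = ⊤ := ordAt_eq_top_iff.mpr (hf x)
  refine ⟨(MeromorphicAt.const 0 _).congr ?_, htop ▸ le_top⟩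
  filter_upwards [meromorphicOrderAt_eq_top_iff.mp htop] with z hz using hz.symm

theorem mem_sectionSpace_add_single_one_and_notMem_iff {D : X →₀ ℤ} {q : X} {f : X → ℂ} :
    f ∈ sectionSpace (D + Finsupp.single q 1) ∧ f ∉ sectionSpace D ↔
      (∀ x, MeroAt f x) ∧ (∀ x, x ≠ q → ((-(D x) : ℤ) : WithTop ℤ) ≤ ordAt f x) ∧
        ordAt f q = ((-(D q) - 1 : ℤ) : WithTop ℤ) := by
  have hoff : ∀ x, x ≠ q → (D + Finsupp.single q 1 : X →₀ ℤ) x = D x := fun x hx => by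
    rw [Finsupp.add_apply, Finsupp.single_eq_of_ne hx, add_zero]
  have hat : -((D + Finsupp.single q 1 : X →₀ ℤ) q) = -(D q) - 1 := by
    rw [Finsupp.add_apply, Finsupp.single_eq_same, neg_add']
  rw [withTop_eq_sub_one_iff]
  constructor
  · rintro ⟨hf, hf'⟩
    have hford : ∀ x, x ≠ q → ((-(D x) : ℤ) : WithTop ℤ) ≤ ordAt f x := fun x hx =>
      hoff x hx ▸ (hf x).2
    refine ⟨fun x => (hf x).1, hford, hat ▸ (hf q).2, fun hq => hf' fun x => ⟨(hf x).1, ?_⟩⟩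
    obtain rfl | hx := eq_or_ne x q
    exacts [hq, hford x hx]
  · rintro ⟨hf, hford, hle, hlt⟩
    refine ⟨fun x => ⟨hf x, ?_⟩, fun hmem => hlt (hmem q).2⟩
    obtain rfl | hx := eq_or_ne x q
    exacts [hat ▸ hle, (hoff x hx).symm ▸ hford x hx]

theorem isNonGap_iff {D : X →₀ ℤ} {p : X} {b : ℕ} :
    IsNonGap D p b ↔ ¬sectionSpace (D + Finsupp.single p ((b : ℤ) - 1) + Finsupp.single p 1) ≤
      sectionSpace (D + Finsupp.single p ((b : ℤ) - 1)) := by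
  rw [SetLike.not_le_iff_exists]
  refine exists_congr fun f => ?_
  rw [mem_sectionSpace_add_single_one_and_notMem_iff, withTop_add_eq_coe_iff]
  refine and_congr_right fun _ => and_congr (forall₂_congr fun x hx => ?_) ?_
  · rw [Finsupp.add_apply, Finsupp.single_eq_of_ne hx, add_zero, withTop_neg_le_iff]
  · rw [Finsupp.add_apply, Finsupp.single_eq_same]
    ring_nf

theorem exists_sub_smul_mem_sectionSpace {D : X →₀ ℤ} {q : X} {f g : X → ℂ}
    (hf : f ∈ sectionSpace (D + Finsupp.single q 1))
    (hg : g ∈ sectionSpace (D + Finsupp.single q 1)) (hg' : g ∉ sectionSpace D) :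
    ∃ c : ℂ, f - c • g ∈ sectionSpace D := by
  by_cases hf' : f ∈ sectionSpace D
  · exact ⟨0, by simpa using hf'⟩
  have hford := (mem_sectionSpace_add_single_one_and_notMem_iff.mp ⟨hf, hf'⟩).2.2
  have hgord := (mem_sectionSpace_add_single_one_and_notMem_iff.mp ⟨hg, hg'⟩).2.2
  obtain ⟨c, hc⟩ := exists_add_one_le_meromorphicOrderAt_sub_smul (hf q).1 (hg q).1 hford.ge hgord
  rw [sub_add_cancel] at hc
  by_contra! hnot
  have hord := (mem_sectionSpace_add_single_one_and_notMem_iff.mp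
    ⟨Submodule.sub_mem _ hf (Submodule.smul_mem _ c hg), hnot c⟩).2.2
  exact (withTop_eq_sub_one_iff.mp hord).2 hc

/-- The space of sections of `O(D)`, where functions that agree off a discrete set are
identified. -/
def secQuot (D : X →₀ ℤ) : Submodule ℂ ((X → ℂ) ⧸ nullFun X) :=
  (sectionSpace D).map (nullFun X).mkQ

theorem mkQ_mem_secQuot {D : X →₀ ℤ} {f : X → ℂ} :
    (nullFun X).mkQ f ∈ secQuot D ↔ f ∈ sectionSpace D := by
  rw [secQuot, ← Submodule.mem_comap, Submodule.comap_map_mkQ,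
    sup_eq_right.mpr (nullFun_le_sectionSpace D)]

theorem secQuot_le_secQuot_add_single_one (D : X →₀ ℤ) (q : X) :
    secQuot D ≤ secQuot (D + Finsupp.single q 1) :=
  Submodule.map_mono (sectionSpace_mono (le_add_single_one D q))

theorem secQuot_add_single_one_le_iff {D : X →₀ ℤ} {q : X} :
    secQuot (D + Finsupp.single q 1) ≤ secQuot D ↔
      sectionSpace (D + Finsupp.single q 1) ≤ sectionSpace D :=
  ⟨fun h _ hf => mkQ_mem_secQuot.mp (h (mkQ_mem_secQuot.mpr hf)), fun h => Submodule.map_mono h⟩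

theorem exists_sub_smul_mem_secQuot {D : X →₀ ℤ} {q : X} :
    ∀ g ∈ secQuot (D + Finsupp.single q 1), g ∉ secQuot D →
      ∀ f ∈ secQuot (D + Finsupp.single q 1), ∃ c : ℂ, f - c • g ∈ secQuot D := by
  rintro _ ⟨g, hg, rfl⟩ hg' _ ⟨f, hf, rfl⟩
  obtain ⟨c, hc⟩ := exists_sub_smul_mem_sectionSpace hf hg (mt mkQ_mem_secQuot.mpr hg')
  exact ⟨c, mkQ_mem_secQuot.mpr hc⟩

theorem finiteDimensional_secQuot_add_single_one {D : X →₀ ℤ} (q : X)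
    [FiniteDimensional ℂ (secQuot D)] : FiniteDimensional ℂ (secQuot (D + Finsupp.single q 1)) :=
  finiteDimensional_of_forall_sub_smul_mem (secQuot_le_secQuot_add_single_one D q)
    exists_sub_smul_mem_secQuot

open Classical in
theorem finrank_secQuot_add_single_one {D : X →₀ ℤ} (q : X) [FiniteDimensional ℂ (secQuot D)] :
    finrank ℂ (secQuot (D + Finsupp.single q 1)) = finrank ℂ (secQuot D) +
      if sectionSpace (D + Finsupp.single q 1) ≤ sectionSpace D then 0 else 1 := by
  rw [finrank_eq_add_ite_of_forall_sub_smul_mem (secQuot_le_secQuot_add_single_one D q)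
    exists_sub_smul_mem_secQuot, if_congr secQuot_add_single_one_le_iff rfl rfl]

variable [IsManifold 𝓘(ℂ) ω X] [T2Space X] [CompactSpace X] [ConnectedSpace X]

theorem secQuot_eq_bot {D : X →₀ ℤ} (hD : divDegree D < 0) : secQuot D = ⊥ := by
  rw [secQuot, ← le_bot_iff, Submodule.map_le_iff_le_comap, Submodule.comap_bot, Submodule.ker_mkQ]
  exact sectionSpace_le_nullFun hD

open Classical in
theorem finrank_secQuot_add_single_eq_count {D : X →₀ ℤ} (hD : divDegree D = 0) (p : X) (N : ℕ) :
    FiniteDimensional ℂ (secQuot (D + Finsupp.single p ((N : ℤ) - 1))) ∧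
      finrank ℂ (secQuot (D + Finsupp.single p ((N : ℤ) - 1))) = Nat.count (IsNonGap D p) N := by
  induction N with
  | zero =>
    rw [secQuot_eq_bot (by rw [divDegree_add, divDegree_single, hD]; simp)]
    exact ⟨inferInstance, by simp⟩
  | succ N ih =>
    obtain ⟨hfinite, hrank⟩ := ih
    have hsucc : D + Finsupp.single p (((N + 1 : ℕ) : ℤ) - 1) =
        D + Finsupp.single p ((N : ℤ) - 1) + Finsupp.single p 1 := by
      rw [add_assoc, ← Finsupp.single_add]
      push_cast
      ring_nf
    rw [hsucc, finrank_secQuot_add_single_one, hrank, Nat.count_succ]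
    exact ⟨finiteDimensional_secQuot_add_single_one p, by simp only [isNonGap_iff, ite_not]⟩

open Classical in
theorem h0_add_single_eq_count {D : X →₀ ℤ} (hD : divDegree D = 0) (p : X) (N : ℕ) :
    h0 (D + Finsupp.single p ((N : ℤ) - 1)) = Nat.count (IsNonGap D p) N :=
  (finrank_secQuot_add_single_eq_count hD p N).2

open Classical in
theorem mult_eq_count {D : X →₀ ℤ} (hD : divDegree D = 0) (p : X) {k : ℕ} (hk : k ≤ genus X) :
    mult D p k = Nat.count (IsNonGap D p) (genus X - k) := by
  rw [← h0_add_single_eq_count hD, mult, Nat.cast_sub hk, sub_right_comm]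

end Sections

section HolomorphicForms

open Filter Set Module

theorem hasSimpleResidueAt_zero {F : ℂ → ℂ} {z₀ : ℂ} (hF : MeromorphicAt F z₀)
    (h : 0 ≤ meromorphicOrderAt F z₀) : HasSimpleResidueAt F z₀ 0 := by
  obtain ⟨g, hg, hFg⟩ := hF.meromorphicOrderAt_nonneg_iff.mp h
  exact ⟨g, hg, by filter_upwards [hFg] with z hz using by rw [hz, zero_div, zero_add]⟩

theorem exists_ne_zero_hasSimpleResidueAt {F : ℂ → ℂ} {z₀ : ℂ} (hF : MeromorphicAt F z₀)
    (h : meromorphicOrderAt F z₀ = ((-1 : ℤ) : WithTop ℤ)) :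
    ∃ a : ℂ, a ≠ 0 ∧ HasSimpleResidueAt F z₀ a := by
  obtain ⟨G, ⟨p, hp⟩, hG0, hFG⟩ := (meromorphicOrderAt_eq_int_iff hF).mp h
  refine ⟨G z₀, hG0, dslope G z₀, ⟨_, hp.has_fpower_series_dslope_fslope⟩, ?_⟩
  filter_upwards [hFG, self_mem_nhdsWithin] with z hz hne
  rw [hz, dslope_of_ne G hne, slope_def_field, zpow_neg_one, smul_eq_mul, ← add_div,
    add_sub_cancel, inv_mul_eq_div]

theorem withTop_eq_top_of_forall_natCast_le {o : WithTop ℤ}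
    (h : ∀ n : ℕ, ((n : ℤ) : WithTop ℤ) ≤ o) : o = ⊤ := by
  cases o with
  | top => rfl
  | coe o =>
    have hle := WithTop.coe_le_coe.mp (h (o.toNat + 1))
    lia

variable {X : Type*} [TopologicalSpace X] [ChartedSpace ℂ X] [IsManifold 𝓘(ℂ) ω X]

/-- The one-form `s` at the point `x`, as a linear map on the model space. -/
def formAt (s : HolOneForm X) (x : X) : ℂ →L[ℂ] ℂ := s x

/-- The coefficient of `dz` in the expression of a one-form in the chart around `c`. -/
def formLoc (s : HolOneForm X) (c : X) (z : ℂ) : ℂ :=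
  formAt s ((chartAt ℂ c).symm z)
    (tangentCoordChange 𝓘(ℂ) c ((chartAt ℂ c).symm z) ((chartAt ℂ c).symm z) 1)

theorem formLoc_add (s t : HolOneForm X) (c : X) : formLoc (s + t) c = formLoc s c + formLoc t c :=
  rfl

theorem formLoc_zero (c : X) : formLoc (0 : HolOneForm X) c = 0 := rfl

theorem tangentCoordChange_one {c c' : X} {z : ℂ} (hz : z ∈ (chartAt ℂ c).target) :
    tangentCoordChange 𝓘(ℂ) c c' ((chartAt ℂ c).symm z) 1 =
      deriv (fun w => chartAt ℂ c' ((chartAt ℂ c).symm w)) z := by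
  rw [tangentCoordChange_def, ← fderiv_apply_one_eq_deriv]
  simp only [extChartAt, mfld_simps]
  rw [(chartAt ℂ c).right_inv hz, fderivWithin_univ]
  rfl

theorem formLoc_eq_mul_deriv (s : HolOneForm X) {c c' : X} {z : ℂ}
    (hz : z ∈ (chartAt ℂ c).target) (hz' : (chartAt ℂ c).symm z ∈ (chartAt ℂ c').source) :
    formLoc s c z = formLoc s c' (chartAt ℂ c' ((chartAt ℂ c).symm z)) *
      deriv (fun w => chartAt ℂ c' ((chartAt ℂ c).symm w)) z := by
  rw [formLoc, formLoc, (chartAt ℂ c').left_inv hz', ← tangentCoordChange_one hz]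
  set x := (chartAt ℂ c).symm z
  have hcocycle := tangentCoordChange_comp (I := 𝓘(ℂ)) (w := c) (x := c') (y := x) (z := x)
    (v := (1 : ℂ)) (by
      simp only [extChartAt_source]
      exact ⟨⟨(chartAt ℂ c).map_target hz, hz'⟩, mem_chart_source ℂ x⟩)
  have hlin (L : ℂ →L[ℂ] ℂ) (a : ℂ) : L a = L 1 * a := by
    rw [mul_comm, ← smul_eq_mul, ← L.map_smul, smul_eq_mul, mul_one]
  rw [← hcocycle]
  exact hlin ((formAt s x).comp (tangentCoordChange 𝓘(ℂ) c' x x)) _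

theorem analyticAt_formLoc_self (s : HolOneForm X) (c : X) :
    AnalyticAt ℂ (formLoc s c) (chartAt ℂ c c) := by
  have hcoord := ((contMDiffAt_hom_bundle _).mp (s.contMDiff c)).2
  have hmdiff : ContMDiffAt 𝓘(ℂ) 𝓘(ℂ) ω (fun x : X => formLoc s c (chartAt ℂ c x)) c := by
    refine (hcoord.clm_apply (contMDiffAt_const (c := (1 : ℂ)))).congr_of_eventuallyEq ?_
    filter_upwards [chart_source_mem_nhds ℂ c] with x hx
    rw [formLoc, (chartAt ℂ c).left_inv hx]
    simp only [ContinuousLinearMap.inCoordinates]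
    rw [TangentBundle.symmL_trivializationAt_eq_core hx]
    simp only [Bundle.Trivial.fiberBundle_trivializationAt',
      Bundle.Trivial.continuousLinearMapAt_trivialization, ContinuousLinearMap.id_comp]
    rfl
  have hdiff := (contMDiffAt_iff.mp hmdiff).2
  simp only [extChartAt, mfld_simps] at hdiff
  rw [contDiffWithinAt_univ] at hdiff
  refine hdiff.analyticAt.congr ?_
  filter_upwards [chart_target_mem_nhds ℂ c] with z hz
  simp only [Function.comp, chartAt_self_eq, OpenPartialHomeomorph.refl_apply]
  rw [(chartAt ℂ c).right_inv hz]
  rfl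

theorem analyticAt_formLoc (s : HolOneForm X) {c : X} {z : ℂ} (hz : z ∈ (chartAt ℂ c).target) :
    AnalyticAt ℂ (formLoc s c) z := by
  set y := (chartAt ℂ c).symm z
  have htransition : AnalyticAt ℂ (fun w => chartAt ℂ y ((chartAt ℂ c).symm w)) z :=
    analyticAt_transition (chart_mem_atlas ℂ c) (chart_mem_atlas ℂ y) hz (mem_chart_source ℂ y)
  refine (((analyticAt_formLoc_self s y).fun_comp
    (f := fun w => chartAt ℂ y ((chartAt ℂ c).symm w)) htransition).mul htransition.deriv).congr ?_
  filter_upwards [((chartAt ℂ c).continuousAt_symm hz).eventually_mem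
    (chart_source_mem_nhds ℂ y), (chartAt ℂ c).open_target.mem_nhds hz] with w hw hwt
  exact (formLoc_eq_mul_deriv s hwt hw).symm

theorem meromorphicAt_formLoc (s : HolOneForm X) (x : X) :
    MeromorphicAt (formLoc s x) (chartAt ℂ x x) :=
  (analyticAt_formLoc_self s x).meromorphicAt

theorem formLoc_chartAt_self (s : HolOneForm X) (x : X) :
    formLoc s x (chartAt ℂ x x) = formAt s x 1 := by
  rw [formLoc, (chartAt ℂ x).left_inv (mem_chart_source ℂ x),
    tangentCoordChange_self (mem_extChartAt_source x)]

theorem formLoc_chartAt_eq_zero_iff (s : HolOneForm X) {c y : X}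
    (hy : y ∈ (chartAt ℂ c).source) : formLoc s c (chartAt ℂ c y) = 0 ↔ formAt s y = 0 := by
  refine ⟨fun h => ?_, fun h => ?_⟩
  · have hy' := formLoc_eq_mul_deriv s (mem_chart_target ℂ y) (c' := c)
      (by rwa [(chartAt ℂ y).left_inv (mem_chart_source ℂ y)])
    rw [(chartAt ℂ y).left_inv (mem_chart_source ℂ y), h, zero_mul, formLoc_chartAt_self] at hy'
    exact ContinuousLinearMap.ext_ring hy'
  · rw [formLoc, (chartAt ℂ c).left_inv hy, h]
    rfl

theorem eventually_formLoc_chartAt_eq_zero_iff (s : HolOneForm X) (x : X) :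
    ∀ᶠ y in 𝓝[≠] x, formLoc s x (chartAt ℂ x y) = 0 ↔ formAt s y = 0 :=
  eventually_nhdsWithin_of_eventually_nhds <|
    mem_of_superset (chart_source_mem_nhds ℂ x) fun _ hy => formLoc_chartAt_eq_zero_iff s hy

/-- The order of vanishing of a holomorphic one-form. -/
def formOrd (s : HolOneForm X) (x : X) : WithTop ℤ :=
  meromorphicOrderAt (formLoc s x) (chartAt ℂ x x)

theorem formOrd_nonneg (s : HolOneForm X) (x : X) : 0 ≤ formOrd s x :=
  (analyticAt_formLoc_self s x).meromorphicOrderAt_nonneg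

theorem formOrd_eq_top_iff {s : HolOneForm X} {x : X} :
    formOrd s x = ⊤ ↔ ∀ᶠ y in 𝓝[≠] x, formAt s y = 0 := by
  rw [formOrd, meromorphicOrderAt_eq_top_iff, ← map_chartAt_nhdsNE, eventually_map]
  exact eventually_congr (eventually_formLoc_chartAt_eq_zero_iff s x)

theorem formOrd_ne_top_iff {s : HolOneForm X} {x : X} :
    formOrd s x ≠ ⊤ ↔ ∀ᶠ y in 𝓝[≠] x, formAt s y ≠ 0 := by
  rw [formOrd, meromorphicOrderAt_ne_top_iff_eventually_ne_zero (meromorphicAt_formLoc s x),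
    ← map_chartAt_nhdsNE, eventually_map]
  exact eventually_congr ((eventually_formLoc_chartAt_eq_zero_iff s x).mono fun _ => not_congr)

theorem formAt_eq_zero_of_formOrd_eq_top {s : HolOneForm X} {x : X} (h : formOrd s x = ⊤) :
    formAt s x = 0 := by
  rw [← formLoc_chartAt_eq_zero_iff s (mem_chart_source ℂ x)]
  have hzero := (meromorphicOrderAt_eq_top_iff.mp h).frequently
  exact ((analyticAt_formLoc_self s x).frequently_zero_iff_eventually_zero.mp hzero).self_of_nhds

theorem eq_zero_of_formOrd_eq_top [ConnectedSpace X] [T1Space X] {s : HolOneForm X} {p : X}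
    (h : formOrd s p = ⊤) : s = 0 := by
  have hopen : IsOpen {x | formOrd s x = ⊤} := by
    simp only [formOrd_eq_top_iff]
    exact isOpen_setOfPred_eventually_nhdsWithin
  have hclosed : IsClosed {x | formOrd s x = ⊤} := by
    have hcompl : {x | formOrd s x = ⊤}ᶜ = {x | ∀ᶠ y in 𝓝[≠] x, formAt s y ≠ 0} :=
      Set.ext fun x => formOrd_ne_top_iff
    rw [← isOpen_compl_iff, hcompl]
    exact isOpen_setOfPred_eventually_nhdsWithin
  have huniv := IsClopen.eq_univ ⟨hclosed, hopen⟩ ⟨p, h⟩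
  ext1 x
  exact formAt_eq_zero_of_formOrd_eq_top (huniv.ge (mem_univ x))

/-- The holomorphic one-forms `s` with `(s) ≥ E`. -/
def formSpace (E : X →₀ ℤ) : Submodule ℂ (HolOneForm X) where
  carrier := {s | ∀ x, ((E x : ℤ) : WithTop ℤ) ≤ formOrd s x}
  zero_mem' := by
    intro x
    have htop : formOrd (0 : HolOneForm X) x = ⊤ := by
      rw [formOrd, formLoc_zero, meromorphicOrderAt_eq_top_iff]
      exact Eventually.of_forall fun _ => rfl
    exact htop ▸ le_top
  add_mem' := by
    intro s t hs ht x
    rw [formOrd, formLoc_add]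
    exact le_trans (le_min (hs x) (ht x))
      (meromorphicOrderAt_add (meromorphicAt_formLoc s x) (meromorphicAt_formLoc t x))
  smul_mem' := by
    intro c s hs x
    have hord : formOrd (c • s) x
        = meromorphicOrderAt (fun _ : ℂ => c) (chartAt ℂ x x) + formOrd s x :=
      meromorphicOrderAt_smul (MeromorphicAt.const c _) (meromorphicAt_formLoc s x)
    rw [hord]
    exact le_trans (hs x) (le_add_of_nonneg_left analyticAt_const.meromorphicOrderAt_nonneg)

theorem formSpace_anti {E E' : X →₀ ℤ} (h : E ≤ E') : formSpace E' ≤ formSpace E :=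
  fun _ hs x => le_trans (WithTop.coe_le_coe.mpr (h x)) (hs x)

theorem formSpace_zero : formSpace (0 : X →₀ ℤ) = ⊤ :=
  eq_top_iff.mpr fun s _ x => formOrd_nonneg s x

theorem mem_formSpace_add_single_one {E : X →₀ ℤ} {q : X} {s : HolOneForm X}
    (hs : s ∈ formSpace E) (h : ((E q + 1 : ℤ) : WithTop ℤ) ≤ formOrd s q) :
    s ∈ formSpace (E + Finsupp.single q 1) := by
  intro x
  obtain rfl | hx := eq_or_ne x q
  · rwa [Finsupp.add_apply, Finsupp.single_eq_same]
  · rw [Finsupp.add_apply, Finsupp.single_eq_of_ne hx, add_zero]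
    exact hs x

theorem formOrd_eq_of_notMem {E : X →₀ ℤ} {q : X} {s : HolOneForm X} (hs : s ∈ formSpace E)
    (hs' : s ∉ formSpace (E + Finsupp.single q 1)) : formOrd s q = ((E q : ℤ) : WithTop ℤ) := by
  have h := withTop_eq_sub_one_iff (o := formOrd s q) (n := E q + 1)
  rw [add_sub_cancel_right] at h
  exact h.mpr ⟨hs q, fun hle => hs' (mem_formSpace_add_single_one hs hle)⟩

theorem exists_sub_smul_mem_formSpace {E : X →₀ ℤ} {q : X} :
    ∀ t ∈ formSpace E, t ∉ formSpace (E + Finsupp.single q 1) →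
      ∀ s ∈ formSpace E, ∃ c : ℂ, s - c • t ∈ formSpace (E + Finsupp.single q 1) := by
  intro t ht ht' s hs
  obtain ⟨c, hc⟩ := exists_add_one_le_meromorphicOrderAt_sub_smul (meromorphicAt_formLoc s q)
    (meromorphicAt_formLoc t q) (hs q) (formOrd_eq_of_notMem ht ht')
  exact ⟨c, mem_formSpace_add_single_one (Submodule.sub_mem _ hs (Submodule.smul_mem _ c ht)) hc⟩

theorem finrank_formSpace_le_add_one [FiniteDimensional ℂ (HolOneForm X)] (E : X →₀ ℤ) (q : X) :
    finrank ℂ (formSpace E) ≤ finrank ℂ (formSpace (E + Finsupp.single q 1)) + 1 := by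
  classical
  rw [finrank_eq_add_ite_of_forall_sub_smul_mem (formSpace_anti (le_add_single_one E q))
    exists_sub_smul_mem_formSpace]
  split_ifs <;> lia

theorem exists_formSpace_single_eq_bot [ConnectedSpace X] [T1Space X]
    [FiniteDimensional ℂ (HolOneForm X)] (p : X) :
    ∃ N : ℕ, formSpace (Finsupp.single p (N : ℤ)) = ⊥ := by
  obtain ⟨N, hN⟩ := IsArtinian.monotone_stabilizes (R := ℂ) (M := HolOneForm X)
    ⟨fun n : ℕ => OrderDual.toDual (formSpace (Finsupp.single p (n : ℤ))), fun m n hmn =>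
      formSpace_anti (Finsupp.single_mono (Int.ofNat_le.mpr hmn))⟩
  refine ⟨N, eq_bot_iff.mpr fun s hs => ?_⟩
  refine eq_zero_of_formOrd_eq_top (p := p) (withTop_eq_top_of_forall_natCast_le fun n => ?_)
  obtain hn | hn := le_total n N
  · refine le_trans (WithTop.coe_le_coe.mpr (Int.ofNat_le.mpr hn)) ?_
    simpa only [Finsupp.single_eq_same] using hs p
  · have hs' : s ∈ formSpace (Finsupp.single p (n : ℤ)) :=
      (congrArg OrderDual.ofDual (hN n hn)).le hs
    simpa only [Finsupp.single_eq_same] using hs' p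

theorem isFormHolomorphicOff_mul_formLoc {f : X → ℂ} {P : Finset X}
    (hP : ∀ y, y ∉ P → HolAt f y) (s : HolOneForm X) :
    IsFormHolomorphicOff P fun c z => f ((chartAt ℂ c).symm z) * formLoc s c z where
  eq_mul_deriv c c' z hz hz' _ := by
    rw [formLoc_eq_mul_deriv s hz hz', (chartAt ℂ c').left_inv hz', mul_assoc]
  analyticAt _ _ hz hzP := ((hP _ hzP).analyticAt hz).mul (analyticAt_formLoc s hz)

variable [T2Space X] [CompactSpace X]

theorem formSpace_le_formSpace_add_single_one {E : X →₀ ℤ} {q : X}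
    (h : ¬sectionSpace (E + Finsupp.single q 1) ≤ sectionSpace E) :
    formSpace E ≤ formSpace (E + Finsupp.single q 1) := by
  classical
  obtain ⟨f, hf, hf'⟩ := SetLike.not_le_iff_exists.mp h
  obtain ⟨hmero, hoff, hq⟩ := mem_sectionSpace_add_single_one_and_notMem_iff.mp ⟨hf, hf'⟩
  have hfin : {y | HolAt f y}ᶜ.Finite :=
    finite_compl_of_eventually_nhdsNE fun x => eventually_holAt (hmero x)
  have hP : ∀ y, y ∉ insert q hfin.toFinset → HolAt f y := fun y hy =>
    not_not.mp (mt hfin.mem_toFinset.mpr fun hmem => hy (Finset.mem_insert_of_mem hmem))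
  intro s hs
  by_contra hs'
  -- The form `f s` has a simple pole at `q` and no other poles, against the residue theorem.
  let η : X → ℂ → ℂ := fun c z => f ((chartAt ℂ c).symm z) * formLoc s c z
  have hη (x : X) : MeromorphicAt (η x) (chartAt ℂ x x) :=
    (hmero x).mul (meromorphicAt_formLoc s x)
  have hηord (x : X) : meromorphicOrderAt (η x) (chartAt ℂ x x) = ordAt f x + formOrd s x :=
    meromorphicOrderAt_mul (hmero x) (meromorphicAt_formLoc s x)
  obtain ⟨a, ha, hres⟩ := exists_ne_zero_hasSimpleResidueAt (hη q) (by
    rw [hηord, hq, formOrd_eq_of_notMem hs hs', ← WithTop.coe_add]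
    ring_nf)
  have hsum := sum_residue_eq_zero (isFormHolomorphicOff_mul_formLoc hP s)
    (r := fun x => if x = q then a else 0) fun x _ => ?_
  · rw [Finset.sum_ite_eq', if_pos (Finset.mem_insert_self _ _)] at hsum
    exact ha hsum
  · obtain rfl | hx := eq_or_ne x q
    · rwa [if_pos rfl]
    · rw [if_neg hx]
      refine hasSimpleResidueAt_zero (hη x) ?_
      rw [hηord]
      refine le_trans ?_ (add_le_add (hoff x hx) (hs x))
      rw [← WithTop.coe_add, neg_add_cancel]
      rfl

theorem effective_induction {X : Type*} {C : (X →₀ ℤ) → Prop} (zero : C 0)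
    (add : ∀ E q, C E → C (E + Finsupp.single q 1)) {E : X →₀ ℤ} (hE : 0 ≤ E) : C E := by
  classical
  induction hn : (divDegree E).toNat using Nat.strong_induction_on generalizing E with
  | _ n ih =>
    obtain rfl | hne := eq_or_ne E 0
    · exact zero
    obtain ⟨q, hq⟩ := Finsupp.ne_iff.mp hne
    have hE' : 0 ≤ E - Finsupp.single q 1 := by
      intro x
      have hx := hE x
      rw [Finsupp.coe_zero, Pi.zero_apply] at hx hq
      rw [Finsupp.coe_zero, Pi.zero_apply, Finsupp.sub_apply, sub_nonneg, Finsupp.single_apply]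
      split_ifs with hqx
      · subst hqx
        lia
      · exact hx
    have hdeg : divDegree E = divDegree (E - Finsupp.single q 1) + 1 := by
      have h := divDegree_add (E - Finsupp.single q 1) (Finsupp.single q 1)
      rwa [sub_add_cancel, divDegree_single] at h
    have hpos : 0 ≤ divDegree (E - Finsupp.single q 1) := Finset.sum_nonneg fun x _ => hE' x
    rw [← sub_add_cancel E (Finsupp.single q 1)]
    exact add _ q (ih _ (by lia) hE' rfl)

variable [ConnectedSpace X]

theorem finiteDimensional_secQuot_zero_and_h0_zero_le_one :
    FiniteDimensional ℂ (secQuot (0 : X →₀ ℤ)) ∧ h0 (0 : X →₀ ℤ) ≤ 1 := by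
  classical
  obtain ⟨p⟩ : Nonempty X := inferInstance
  have hcount := finrank_secQuot_add_single_eq_count (D := (0 : X →₀ ℤ)) rfl p 1
  rw [Nat.cast_one, sub_self, Finsupp.single_zero, add_zero] at hcount
  exact ⟨hcount.1, hcount.2.trans_le (Nat.count_le _)⟩

/-- Adding a point to `E` cannot both create a section and remove a form, since their product would
violate the residue theorem. -/
theorem h0_add_genus_le [FiniteDimensional ℂ (HolOneForm X)] {E : X →₀ ℤ} (hE : 0 ≤ E) :
    FiniteDimensional ℂ (secQuot E) ∧
      (h0 E + genus X : ℤ) ≤ divDegree E + 1 + finrank ℂ (formSpace E) := by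
  classical
  refine effective_induction (C := fun E => FiniteDimensional ℂ (secQuot E) ∧
    (h0 E + genus X : ℤ) ≤ divDegree E + 1 + finrank ℂ (formSpace E)) ?_ ?_ hE
  · obtain ⟨hfinite, hle⟩ := finiteDimensional_secQuot_zero_and_h0_zero_le_one (X := X)
    refine ⟨hfinite, ?_⟩
    rw [formSpace_zero, finrank_top, ← genus, divDegree, Finsupp.sum_zero_index]
    lia
  · rintro E q ⟨hfinite, hle⟩
    refine ⟨finiteDimensional_secQuot_add_single_one q, ?_⟩
    have hh0 : h0 (E + Finsupp.single q 1) = h0 E + _ := finrank_secQuot_add_single_one q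
    rw [hh0, divDegree_add, divDegree_single]
    split_ifs with h
    · have hform := finrank_formSpace_le_add_one E q
      lia
    · rw [le_antisymm (formSpace_anti (le_add_single_one E q))
        (formSpace_le_formSpace_add_single_one h)]
      push_cast
      lia

end HolomorphicForms

section Gaps

open Filter Set Module

variable {X : Type*} [TopologicalSpace X]

/-- Multiplication by a function, on functions modulo functions that vanish off a discrete
set. -/
def mulQuot (h : X → ℂ) : ((X → ℂ) ⧸ nullFun X) →ₗ[ℂ] ((X → ℂ) ⧸ nullFun X) :=
  (nullFun X).mapQ (nullFun X) (LinearMap.mulLeft ℂ h) fun f hf x => by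
    filter_upwards [hf x] with y hy
    rw [LinearMap.mulLeft_apply, Pi.mul_apply, hy, mul_zero]

theorem mulQuot_mkQ (h f : X → ℂ) :
    mulQuot h ((nullFun X).mkQ f) = (nullFun X).mkQ (h * f) := rfl

theorem mulQuot_injective {h : X → ℂ} (hne : ∀ x, ∀ᶠ y in 𝓝[≠] x, h y ≠ 0) :
    Function.Injective (mulQuot h) := by
  rw [← LinearMap.ker_eq_bot, LinearMap.ker_eq_bot']
  intro v hv
  obtain ⟨f, rfl⟩ := Submodule.mkQ_surjective _ v
  rw [mulQuot_mkQ] at hv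
  have hmem : h * f ∈ nullFun X := (Submodule.Quotient.mk_eq_zero _).mp hv
  refine (Submodule.Quotient.mk_eq_zero _).mpr fun x => ?_
  filter_upwards [hmem x, hne x] with y hmul hy
  exact (mul_eq_zero.mp hmul).resolve_left hy

variable [ChartedSpace ℂ X]

theorem inv_mul_mem_sectionSpace_add {f₀ f : X → ℂ} {D E : X →₀ ℤ} (hf₀ : ∀ x, MeroAt f₀ x)
    (hE : ∀ x, ordAt f₀ x = E x) (hf : f ∈ sectionSpace D) :
    f₀⁻¹ * f ∈ sectionSpace (D + E) := by
  refine fun x => ⟨(hf₀ x).inv.mul (hf x).1, ?_⟩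
  have hinv : ordAt f₀⁻¹ x = ((-(E x) : ℤ) : WithTop ℤ) := by
    rw [show ordAt f₀⁻¹ x = -ordAt f₀ x from meromorphicOrderAt_inv, hE x]
    rfl
  rw [show ordAt (f₀⁻¹ * f) x = ordAt f₀⁻¹ x + ordAt f x from
    meromorphicOrderAt_mul (hf₀ x).inv (hf x).1, hinv, Finsupp.add_apply, neg_add_rev,
    WithTop.coe_add]
  exact add_le_add_right (hf x).2 _

theorem h0_le_h0_add {f₀ : X → ℂ} {E : X →₀ ℤ} (hf₀ : ∀ x, MeroAt f₀ x)
    (hE : ∀ x, ordAt f₀ x = E x) (D : X →₀ ℤ) [FiniteDimensional ℂ (secQuot (D + E))] :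
    h0 D ≤ h0 (D + E) := by
  have hne : ∀ x, ∀ᶠ y in 𝓝[≠] x, (f₀⁻¹) y ≠ 0 := fun x =>
    ((eventually_ne_zero_iff (hf₀ x)).mpr (hE x ▸ WithTop.coe_ne_top)).mono fun _ => inv_ne_zero
  have hmap : (secQuot D).map (mulQuot f₀⁻¹) ≤ secQuot (D + E) := by
    rintro _ ⟨_, ⟨f, hf, rfl⟩, rfl⟩
    exact mkQ_mem_secQuot.mpr (inv_mul_mem_sectionSpace_add hf₀ hE hf)
  calc h0 D = finrank ℂ ((secQuot D).map (mulQuot f₀⁻¹)) :=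
        (Submodule.equivMapOfInjective _ (mulQuot_injective hne) (secQuot D)).finrank_eq
    _ ≤ h0 (D + E) := Submodule.finrank_mono (t := secQuot (D + E)) hmap

variable [IsManifold 𝓘(ℂ) ω X] [T2Space X] [CompactSpace X] [ConnectedSpace X]
  {D : X →₀ ℤ} {p : X}

theorem IsNonGap.exists_single_le_add {b : ℕ} (hb : IsNonGap D p b) :
    ∃ (f₀ : X → ℂ) (E : X →₀ ℤ), (∀ x, MeroAt f₀ x) ∧ (∀ x, ordAt f₀ x = E x) ∧
      divDegree E = 0 ∧ ∀ N : ℕ, Finsupp.single p (N : ℤ) ≤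
        D + Finsupp.single p ((b + N : ℕ) : ℤ) + E := by
  obtain ⟨f₀, hf₀, hoff, hpole⟩ := hb
  have hnull : f₀ ∉ nullFun X := fun h => by
    rw [ordAt_eq_top_iff.mpr (h p), WithTop.top_add] at hpole
    exact WithTop.coe_ne_top hpole.symm
  obtain ⟨E, hE⟩ := exists_forall_ordAt_eq_coe hf₀ hnull
  refine ⟨f₀, E, hf₀, hE, divDegree_eq_zero hf₀ hE, fun N x => ?_⟩
  rw [Finsupp.add_apply, Finsupp.add_apply]
  obtain rfl | hx := eq_or_ne x p
  · rw [hE x] at hpole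
    norm_cast at hpole
    rw [Finsupp.single_eq_same, Finsupp.single_eq_same]
    lia
  · have hEx := hoff x hx
    rw [hE x] at hEx
    norm_cast at hEx
    rw [Finsupp.single_eq_of_ne hx, Finsupp.single_eq_of_ne hx]
    lia

theorem IsNonGap.exists_h0_add_genus_le [FiniteDimensional ℂ (HolOneForm X)] {b : ℕ}
    (hD : divDegree D = 0) (hb : IsNonGap D p b) :
    ∃ N : ℕ, h0 (D + Finsupp.single p (N : ℤ)) + genus X ≤ N + 1 := by
  obtain ⟨f₀, E, hf₀, hE, hEdeg, hle⟩ := hb.exists_single_le_add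
  obtain ⟨N, hN⟩ := exists_formSpace_single_eq_bot p
  refine ⟨b + N, ?_⟩
  have hpos : 0 ≤ D + Finsupp.single p ((b + N : ℕ) : ℤ) + E :=
    (Finsupp.single_nonneg.mpr (Int.natCast_nonneg N)).trans (hle N)
  obtain ⟨_, hRR⟩ := h0_add_genus_le hpos
  have hbot : formSpace (D + Finsupp.single p ((b + N : ℕ) : ℤ) + E) = ⊥ :=
    le_bot_iff.mp (hN ▸ formSpace_anti (hle N))
  rw [hbot, finrank_bot, divDegree_add, divDegree_add,
    divDegree_single, hD, hEdeg] at hRR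
  have := h0_le_h0_add hf₀ hE (D + Finsupp.single p ((b + N : ℕ) : ℤ))
  lia

open Classical in
theorem exists_genus_le_count_not_isNonGap (hD : divDegree D = 0) (p : X) :
    ∃ N, genus X ≤ Nat.count (fun b => ¬ IsNonGap D p b) N := by
  by_cases hfin : FiniteDimensional ℂ (HolOneForm X)
  swap
  · exact ⟨0, (finrank_of_not_finite hfin).trans_le (Nat.zero_le _)⟩
  by_cases hnonGap : ∃ b, IsNonGap D p b
  · obtain ⟨b, hb⟩ := hnonGap
    obtain ⟨N, hN⟩ := hb.exists_h0_add_genus_le hD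
    have hcount := h0_add_single_eq_count hD p (N + 1)
    rw [Nat.cast_succ, add_sub_cancel_right] at hcount
    have := count_add_count_not (IsNonGap D p) (N + 1)
    exact ⟨N + 1, by lia⟩
  · push Not at hnonGap
    exact ⟨genus X, (Nat.count_iff_forall.mpr fun b _ => hnonGap b).ge⟩

theorem gap_lt_gap (hD : divDegree D = 0) {i j : ℕ} (hij : i < j) (hj : j < genus X) :
    gap D p i < gap D p j := by
  classical
  obtain ⟨N, hN⟩ := exists_genus_le_count_not_isNonGap hD p
  exact Nat.nth_lt_nth' hij (lt_card_of_lt_count (P := fun b => ¬ IsNonGap D p b) (hj.trans_le hN))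

open Classical in
theorem le_gap_of_count_le (hD : divDegree D = 0) {j n : ℕ} (hj : j < genus X)
    (h : Nat.count (fun b => ¬ IsNonGap D p b) n ≤ j) : n ≤ gap D p j := by
  obtain ⟨N, hN⟩ := exists_genus_le_count_not_isNonGap hD p
  exact le_nth_of_count_le (P := fun b => ¬ IsNonGap D p b) (hj.trans_le hN) h

theorem isPartition_gapPartition (hD : divDegree D = 0) :
    IsPartition (genus X) (gapPartition D p) := by
  classical
  refine ⟨antitone_nat_of_succ_le fun i => ?_, fun i hi => if_neg (by lia)⟩
  rw [gapPartition, gapPartition]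
  split_ifs
  · have := gap_lt_gap (p := p) hD (show genus X - 1 - (i + 1) < genus X - 1 - i by lia) (by lia)
    lia
  · lia
  · exact Nat.zero_le _
  · exact le_rfl

theorem lt_gapPartition (hD : divDegree D = 0) {i : ℕ} (hi : i < mult D p 0) :
    i < gapPartition D p i := by
  classical
  have hmult := mult_eq_count hD p (Nat.zero_le (genus X))
  have hcount := count_add_count_not (IsNonGap D p) (genus X - 0)
  have hle : genus X ≤ gap D p (genus X - 1 - i) :=
    le_gap_of_count_le hD (by lia) (by rw [Nat.sub_zero] at hcount hmult; lia)
  rw [gapPartition, if_pos (by lia)]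
  lia

theorem mult_le_of_gapPartition_le (hD : divDegree D = 0) {l : ℕ} {μ : ℕ → ℕ}
    (hμ : IsPartition l μ) (hle : ∀ i, gapPartition D p i ≤ μ i) : mult D p 0 ≤ l := by
  by_contra! hlt
  have := (lt_gapPartition hD hlt).trans_le (hle l)
  exact absurd (hμ.2 l le_rfl) (by lia)

open Classical in
theorem isGapPerm_gapPerm (hD : divDegree D = 0) {k : ℕ} (hk : k ≤ genus X) :
    IsGapPerm D p k (gapPerm (IsNonGap D p) (genus X - k)) := by
  intro i
  rw [gapPerm_symm_rev, gapRow, topRow, mult_eq_count hD p hk, Nat.sub_right_comm]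
  rfl

open Classical in
theorem eval_partialT_aSeq_schur (hD : divDegree D = 0) {k : ℕ} (hk : k ≤ genus X) {l : ℕ}
    {μ : ℕ → ℕ} (hμ : IsPartition l μ) (hμgap : ∀ i, k ≤ i → μ i = gapPartition D p i)
    (x : Fin k → ℂ) :
    MvPolynomial.eval (bracketSum x) (partialT (aSeq D p k) (schur l μ)) =
      ((Equiv.Perm.sign (gapPerm (IsNonGap D p) (genus X - k)) : ℤ) : ℂ) *
        MvPolynomial.eval (bracketSum x) (schur k μ) := by
  obtain ⟨N, hN⟩ := exists_genus_le_count_not_isNonGap hD p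
  have hzero : ∀ i, k + (genus X - k) ≤ i → μ i = 0 := fun i hi => by
    rw [hμgap i (by lia), gapPartition, if_neg (by lia)]
  have hlower : ∀ i < genus X - k, μ (k + i) =
      gap D p (genus X - k - 1 - i) - (genus X - k - 1 - i) := fun i hi => by
    rw [hμgap (k + i) (by lia), gapPartition, if_pos (by lia),
      show genus X - 1 - (k + i) = genus X - k - 1 - i by lia]
  rw [schur_congr_length hμ.2 hzero, aSeq, mult_eq_count hD p hk]
  exact eval_partialT_schur ((Nat.sub_le _ _).trans hN) hμ.1 hlower x

end Gaps

end

end RiemannSchur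

open RiemannSchur in
theorem mainTheorem8 {X : Type*} [TopologicalSpace X] [T2Space X] [CompactSpace X]
    [ConnectedSpace X] [ChartedSpace ℂ X] [IsManifold 𝓘(ℂ) ω X]
    (p : X) (D : X →₀ ℤ) (hD : divDegree D = 0) :
    -- derivatives along the a-sequence, restricted to sums of `k` points
    (∀ k : ℕ, k < genus X → 0 < mult D p k →
      ∃ σ : Equiv.Perm (Fin (genus X - k)), IsGapPerm D p k σ ∧
        ∀ (l : ℕ) (μ : ℕ → ℕ), IsPartition l μ → (∀ i, k ≤ i → μ i = gapPartition D p i) →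
          ∀ x : Fin k → ℂ,
            MvPolynomial.eval (bracketSum x) (partialT (aSeq D p k) (schur l μ)) =
              ((Equiv.Perm.sign σ : ℤ) : ℂ) * MvPolynomial.eval (bracketSum x) (schur k μ)) ∧
    -- vanishing for reasons of weight
    (∀ (l : ℕ) (μ : ℕ → ℕ), IsPartition l μ →
      ∀ I : List ℕ, I ≠ [] → (∀ i ∈ I, 0 < i) → I.sum ≠ ∑ i ∈ Finset.range l, μ i →
        MvPolynomial.eval (0 : ℕ → ℂ) (partialT I (schur l μ)) = 0) ∧
    -- vanishing of the derivatives of order less than `m_0`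
    (∀ (l : ℕ) (μ : ℕ → ℕ), IsPartition l μ → (∀ i, gapPartition D p i ≤ μ i) →
      ∀ I : List ℕ, (∀ i ∈ I, 0 < i) → I.length < mult D p 0 →
        MvPolynomial.eval (0 : ℕ → ℂ) (partialT I (schur l μ)) = 0) ∧
    -- the non-vanishing derivative of order `m_0`
    (∃ σ : Equiv.Perm (Fin (genus X - 0)), IsGapPerm D p 0 σ ∧
      MvPolynomial.eval (0 : ℕ → ℂ)
          (partialT (aSeq D p 0) (schur (genus X) (gapPartition D p))) =
        ((Equiv.Perm.sign σ : ℤ) : ℂ)) := by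
  classical
  refine ⟨fun k hk _ => ⟨_, isGapPerm_gapPerm hD hk.le, fun l μ hμ hμgap x =>
      eval_partialT_aSeq_schur hD hk.le hμ hμgap x⟩,
    fun l μ _ I _ hI hsum => eval_zero_partialT_schur_of_sum_ne hI hsum,
    fun l μ hμ hle I hI hlen => ?_, ⟨_, isGapPerm_gapPerm hD (Nat.zero_le _), ?_⟩⟩
  · exact eval_zero_partialT_schur_of_length_lt hI hlen (mult_le_of_gapPartition_le hD hμ hle)
      fun i hi => (lt_gapPartition hD hi).trans_le (hle i)
  · rw [← bracketSum_of_isEmpty Fin.elim0, eval_partialT_aSeq_schur hD (Nat.zero_le _)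
      (isPartition_gapPartition hD) fun _ _ => rfl, schur, Matrix.det_isEmpty, map_one, mul_one]
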